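/- **Setting (synthetic differential geometry).** Let $k$ be a field, let $\mathcal C$ be a cartesian closed category with finite limits (for instance a topos), and let $R$ be a commutative ring object of $\mathcal C$ that is a $k$-algebra. Elements are generalized elements, and subobjects and maps are described by the usual internal set-like notation. A *Weil algebra* is a finite-dimensional commutative $k$-algebra $W=k\oplus I$ with $I$ a nilpotent ideal; its infinitesimal object $\operatorname{Spec}W$ is the object of $k$-algebra homomorphisms $W\to R$. Assume the general Kock–Lawvere axiom: for every Weil algebra $W$ the canonical map $W\otimes_k R\to R^{\operatorname{Spec}W}$ is an isomorphism. For $n\ge 0$ put $D_n=\{d\in R\mid d^{\,n+1}=0\}$, and put $D=D_1$, $D(2)=\{(d_1,d_2)\in D\times D\mid d_1d_2=0\}$. An object $M$ is *microlinear* if the functor $W\mapsto M^{\operatorname{Spec}W}$ sends every finite limit diagram of Weil algebras (a finite diagram of Weil algebras, with a Weil algebra as its limit among commutative $k$-algebras) to a limit diagram. A *Lie group* is a group object of $\mathcal C$ that is microlinear. A *Lie algebra* is a microlinear $R$-module $L$ that is Euclidean (every $f:D\to L$ has the form $f(d)=f(0)+d\,b$ for a unique $b\in L$), with an $R$-bilinear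 antisymmetric bracket that satisfies the Jacobi identity. The Lie algebra $\mathbf{Lie}(G)$ of a Lie group $G$ is $\{X\in G^D\mid X(0)=1\}$ with the operations $$(aX)(d)=X(ad),\qquad (X+Y)(d)=\ell(d,d),\qquad [X,Y](d_1d_2)=X(d_1)\,Y(d_2)\,X(-d_1)\,Y(-d_2),$$ where $\ell:D(2)\to G$ is the unique map with $\ell(d,0)=X(d)$ and $\ell(0,d)=Y(d)$, and where $[X,Y]$ is the unique element of $\mathbf{Lie}(G)$ with the displayed property; the zero is $d\mapsto 1$ and $(-X)(d)=X(-d)$. For an object $U$, the exponential $G^{U}$ of a group object and the exponential $\mathfrak g^{U}$ of a Lie algebra carry the pointwise operations. **Theorem.** Let $G$ be a Lie group with Lie algebra $\mathfrak g=\mathbf{Lie}(G)$, and let $n\ge 0$. Then the Weil prolongation $G^{D_n}$ is a Lie group, and $$\mathbf{Lie}\bigl(G^{D_n}\bigr)=\mathfrak g^{D_n}.$$ More precisely, the exponential law $\bigl(G^{D_n}\bigr)^{D}\cong\bigl(G^{D}\bigr)^{D_n}$, which exchanges the two arguments, restricts to an isomorphism $\mathbf{Lie}(G^{D_n})\cong\mathfrak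 g^{D_n}$, and this is an isomorphism of Lie algebras. -/

import Mathlib

open CategoryTheory Limits MonoidalCategory CartesianMonoidalCategory
open scoped CartesianClosed MonObj AddMonObj RingObj CommRingObj DualNumber commutatorElement
universe w v u
namespace SDG
set_option linter.unusedSectionVars false
noncomputable section

section Setting

variable (k : Type w) [Field k]
variable {C : Type u} [Category.{v} C] [CartesianMonoidalCategory C] [BraidedCategory C]

/-- A commutative ring object `R` is an (internal) `k`-algebra when it is equipped with a ring
homomorphism from `k` to its ring of global elements. -/
class AlgebraObj (R : C) [CommRingObj R] where
  scalars : k →+* (𝟙_ C ⟶ R)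

/-- Restriction along `f : Y ⟶ X` of the `R`-valued functions on `X`. -/
def precomp (R : C) [CommRingObj R] {X Y : C} (f : Y ⟶ X) : (X ⟶ R) →+* (Y ⟶ R) where
  toFun a := f ≫ a
  map_one' := by simp
  map_zero' := by simp
  map_mul' _ _ := MonObj.comp_mul _ _ _
  map_add' _ _ := AddMonObj.comp_add _ _ _

/-- The `k`-algebra of `R`-valued functions on `X`. -/
instance functionAlgebra (R : C) [CommRingObj R] [AlgebraObj k R] (X : C) : Algebra k (X ⟶ R) :=
  ((precomp R (toUnit X)).comp AlgebraObj.scalars).toAlgebra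

lemma algebraMap_eq (R : C) [CommRingObj R] [AlgebraObj k R] (X : C) (c : k) :
    algebraMap k (X ⟶ R) c = toUnit X ≫ (AlgebraObj.scalars c : 𝟙_ C ⟶ R) := rfl

/-- Restriction of functions along `f`, as a homomorphism of `k`-algebras. -/
def pullback (R : C) [CommRingObj R] [AlgebraObj k R] {X Y : C} (f : Y ⟶ X) :
    (X ⟶ R) →ₐ[k] (Y ⟶ R) where
  __ := precomp R f
  commutes' c := by
    change f ≫ (toUnit X ≫ _) = toUnit Y ≫ _
    rw [← Category.assoc]
    congr 1
    exact toUnit_unique _ _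

@[simp] lemma pullback_apply (R : C) [CommRingObj R] [AlgebraObj k R] {X Y : C} (f : Y ⟶ X)
    (a : X ⟶ R) : pullback k R f a = f ≫ a := rfl

/-- A Weil algebra over the field `k`: a finite-dimensional commutative `k`-algebra
`W = k ⊕ I` with `I` a nilpotent ideal. -/
structure IsWeilAlgebra (W : Type w) [CommRing W] [Algebra k W] : Prop where
  finite : Module.Finite k W
  exists_augmentation : ∃ π : W →ₐ[k] k, IsNilpotent (RingHom.ker π)

/-- The category of Weil algebras over `k` and `k`-algebra homomorphisms. -/
abbrev WeilAlg : Type (w + 1) :=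
  ObjectProperty.FullSubcategory (fun W : CommAlgCat.{w} k => IsWeilAlgebra k W)

variable {k}

instance (W : WeilAlg k) : Module.Finite k W.obj := W.property.finite

variable [HasFiniteLimits C] (R : C) [CommRingObj R] [AlgebraObj k R]

/-! ### The infinitesimal object of a Weil algebra

`Spec R W` is the object of `R`-valued points of `W`: its generalized elements of stage `X` are the
`k`-algebra homomorphisms from `W` to the functions `X ⟶ R`.  It is cut out of `R ^ dim W` by the
multiplication table of `W`. -/

/-- The coordinates, on `R ^ dim W`, of the basis of `W`. -/
abbrev coord (W : WeilAlg k) (i : Fin (Module.finrank k W.obj)) :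
    (∏ᶜ fun _ : Fin (Module.finrank k W.obj) => R) ⟶ R := Pi.π _ i

/-- The linear form on `R ^ dim W` given by an element of `W`. -/
def linForm (W : WeilAlg k) :
    W.obj →ₗ[k] ((∏ᶜ fun _ : Fin (Module.finrank k W.obj) => R) ⟶ R) :=
  (Module.finBasis k W.obj).constr k (coord R W)

/-- Left-hand sides `1` and `xᵢ xⱼ` of the equations of `Spec R W`. -/
def specLHS (W : WeilAlg k) : (∏ᶜ fun _ : Fin (Module.finrank k W.obj) => R) ⟶
    ∏ᶜ fun _ : Option (Fin (Module.finrank k W.obj) × Fin (Module.finrank k W.obj)) => R :=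
  Pi.lift fun o => o.elim 1 fun p => coord R W p.1 * coord R W p.2

/-- Right-hand sides of the equations of `Spec R W`. -/
def specRHS (W : WeilAlg k) : (∏ᶜ fun _ : Fin (Module.finrank k W.obj) => R) ⟶
    ∏ᶜ fun _ : Option (Fin (Module.finrank k W.obj) × Fin (Module.finrank k W.obj)) => R :=
  Pi.lift fun o => o.elim (linForm R W 1) fun p =>
    linForm R W (Module.finBasis k W.obj p.1 * Module.finBasis k W.obj p.2)

/-- The infinitesimal object of the Weil algebra `W`. -/
def Spec (W : WeilAlg k) : C := equalizer (specLHS R W) (specRHS R W)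

/-- The inclusion of `Spec R W` into `R ^ dim W`. -/
def specι (W : WeilAlg k) :
    Spec R W ⟶ ∏ᶜ fun _ : Fin (Module.finrank k W.obj) => R :=
  equalizer.ι (specLHS R W) (specRHS R W)

/-- The linear form on `Spec R W` given by an element of `W`. -/
def specGenLin (W : WeilAlg k) : W.obj →ₗ[k] (Spec R W ⟶ R) :=
  (pullback k R (specι R W)).toLinearMap ∘ₗ linForm R W

lemma linForm_basis (W : WeilAlg k) (i) :
    linForm R W (Module.finBasis k W.obj i) = coord R W i := by
  simp [linForm]

lemma specGenLin_apply (W : WeilAlg k) (x : W.obj) :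
    specGenLin R W x = specι R W ≫ linForm R W x := rfl

lemma specι_condition (W : WeilAlg k) : specι R W ≫ specLHS R W = specι R W ≫ specRHS R W :=
  equalizer.condition _ _

lemma specGenLin_one (W : WeilAlg k) : specGenLin R W 1 = 1 := by
  have h : specι R W ≫ (1 : _ ⟶ R) = specι R W ≫ linForm R W 1 := by
    simpa only [Category.assoc, specLHS, specRHS, Pi.lift_π, Option.elim_none, Option.elim_some] using
      specι_condition R W =≫ Pi.π _ none
  rw [specGenLin_apply, ← h, MonObj.comp_one]

lemma specGenLin_mul (W : WeilAlg k) (x y : W.obj) :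
    specGenLin R W (x * y) = specGenLin R W x * specGenLin R W y := by
  have key : (LinearMap.mul k W.obj).compr₂ (specGenLin R W) =
      (LinearMap.mul k (Spec R W ⟶ R)).compl₁₂ (specGenLin R W) (specGenLin R W) := by
    refine (Module.finBasis k W.obj).ext fun i => (Module.finBasis k W.obj).ext fun j => ?_
    have h : specι R W ≫ (coord R W i * coord R W j) = specι R W ≫
        linForm R W (Module.finBasis k W.obj i * Module.finBasis k W.obj j) := by
      simpa only [Category.assoc, specLHS, specRHS, Pi.lift_π, Option.elim_none, Option.elim_some] using
        specι_condition R W =≫ Pi.π _ (some (i, j))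
    rw [MonObj.comp_mul] at h
    simp only [LinearMap.compr₂_apply, LinearMap.mul_apply', LinearMap.compl₁₂_apply,
      specGenLin_apply, linForm_basis]
    exact h.symm
  exact LinearMap.congr_fun (LinearMap.congr_fun key x) y

/-- The generic `R`-valued point of `W`. -/
def specGen (W : WeilAlg k) : W.obj →ₐ[k] (Spec R W ⟶ R) :=
  AlgHom.ofLinearMap (specGenLin R W) (specGenLin_one R W) (specGenLin_mul R W)

variable {R}

/-- `S`, with the `R`-valued point `g` of `W`, represents the `R`-valued points of `W`. -/
def IsSpec {W : Type w} [CommRing W] [Algebra k W] {S : C} (g : W →ₐ[k] (S ⟶ R)) : Prop :=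
  ∀ (X : C) (h : W →ₐ[k] (X ⟶ R)), ∃! f : X ⟶ S, (pullback k R f).comp g = h

lemma isSpec_specGen (W : WeilAlg k) : IsSpec (specGen R W) := by
  intro X h
  have hlin : ∀ x, (Pi.lift fun i => h (Module.finBasis k W.obj i)) ≫ linForm R W x = h x := by
    have : (pullback k R (Pi.lift fun i => h (Module.finBasis k W.obj i))).toLinearMap ∘ₗ
        linForm R W = h.toLinearMap := by
      refine (Module.finBasis k W.obj).ext fun i => ?_
      simp [linForm_basis]
    exact fun x => LinearMap.congr_fun this x
  have heq : (Pi.lift fun i => h (Module.finBasis k W.obj i)) ≫ specLHS R W =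
      (Pi.lift fun i => h (Module.finBasis k W.obj i)) ≫ specRHS R W := by
    refine Pi.hom_ext _ _ fun o => ?_
    cases o with
    | none => simp [specLHS, specRHS, hlin]
    | some p => simp [specLHS, specRHS, hlin, MonObj.comp_mul]
  obtain ⟨l, hl⟩ : ∃ l : X ⟶ Spec R W, l ≫ specι R W =
      Pi.lift fun i => h (Module.finBasis k W.obj i) := ⟨equalizer.lift _ heq, equalizer.lift_ι _ heq⟩
  refine ⟨l, ?_, ?_⟩
  · ext x
    change l ≫ (specι R W ≫ linForm R W x) = h x
    rw [← Category.assoc, hl, hlin]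
  · intro f hf
    refine equalizer.hom_ext ?_
    change f ≫ specι R W = l ≫ specι R W
    rw [hl]
    refine Pi.hom_ext _ _ fun i => ?_
    have := DFunLike.congr_fun hf (Module.finBasis k W.obj i)
    rw [Pi.lift_π, ← this]
    change _ = f ≫ (specι R W ≫ linForm R W _)
    rw [linForm_basis, Category.assoc]

namespace IsSpec

variable {W : Type w} [CommRing W] [Algebra k W] {S : C} {g : W →ₐ[k] (S ⟶ R)}

/-- The morphism classified by an `R`-valued point. -/
def lift (hg : IsSpec g) {X : C} (h : W →ₐ[k] (X ⟶ R)) : X ⟶ S := (hg X h).choose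

lemma lift_spec (hg : IsSpec g) {X : C} (h : W →ₐ[k] (X ⟶ R)) :
    (pullback k R (hg.lift h)).comp g = h := (hg X h).choose_spec.1

lemma hom_ext (hg : IsSpec g) {X : C} {f f' : X ⟶ S}
    (h : (pullback k R f).comp g = (pullback k R f').comp g) : f = f' :=
  (hg X _).unique h rfl

end IsSpec

lemma pullback_comp {X Y Z : C} (f : Z ⟶ Y) (g : Y ⟶ X) :
    pullback k R (f ≫ g) = (pullback k R f).comp (pullback k R g) := by
  ext a; simp

lemma pullback_id (X : C) : pullback k R (𝟙 X) = AlgHom.id k _ := by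
  ext a; simp

variable (R)

/-- A homomorphism of Weil algebras induces a morphism of infinitesimal objects. -/
def specMap {W W' : WeilAlg k} (φ : W ⟶ W') : Spec R W' ⟶ Spec R W :=
  (isSpec_specGen W).lift ((specGen R W').comp φ.hom.hom)

lemma specMap_spec {W W' : WeilAlg k} (φ : W ⟶ W') :
    (pullback k R (specMap R φ)).comp (specGen R W) = (specGen R W').comp φ.hom.hom :=
  (isSpec_specGen W).lift_spec _

/-- `Spec` as a contravariant functor. -/
def specFunctor : (WeilAlg k)ᵒᵖ ⥤ C where
  obj W := Spec R W.unop
  map φ := specMap R φ.unop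
  map_id W := by
    refine (isSpec_specGen _).hom_ext ?_
    rw [specMap_spec, pullback_id]
    rfl
  map_comp φ ψ := by
    refine (isSpec_specGen _).hom_ext ?_
    rw [specMap_spec, pullback_comp, AlgHom.comp_assoc, specMap_spec, ← AlgHom.comp_assoc,
      specMap_spec]
    rfl

/-- The general Kock-Lawvere axiom: for every Weil algebra `W` the canonical homomorphism from
`W ⊗ R` to `R ^ (Spec W)` is an isomorphism, tested on generalized elements. -/
def KockLawvere : Prop :=
  ∀ (W : WeilAlg k) (X : C), Function.Bijective
    (Algebra.TensorProduct.lift ((pullback k R (fst (Spec R W) X)).comp (specGen R W))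
      (pullback k R (snd (Spec R W) X)) (fun _ _ => Commute.all _ _) :
      TensorProduct k W.obj (X ⟶ R) →ₐ[k] (Spec R W ⊗ X ⟶ R))

variable [MonoidalClosed C]

/-- The covariant functor `W ↦ M ^ (Spec W)` on Weil algebras. -/
def specExp (M : C) : WeilAlg k ⥤ C :=
  (specFunctor (k := k) R).rightOp ⋙ MonoidalClosed.internalHom.flip.obj M

variable (k)

/-- `M` is microlinear: the functor `W ↦ M ^ (Spec W)` sends every finite limit diagram of Weil
algebras (a cone of Weil algebras which is a limit cone of commutative `k`-algebras) to a limit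
diagram. -/
def Microlinear (M : C) : Prop :=
  ∀ (J : Type) [SmallCategory J] [FinCategory J] (F : J ⥤ WeilAlg k) (c : Cone F),
    Nonempty (IsLimit ((ObjectProperty.ι _).mapCone c)) →
      Nonempty (IsLimit ((specExp R M).mapCone c))

end Setting

section Infinitesimals

variable {C : Type u} [Category.{v} C] [CartesianMonoidalCategory C] [BraidedCategory C]
  [HasFiniteLimits C] (R : C) [CommRingObj R]

/-- The object `D_n = {d ∈ R | d ^ (n + 1) = 0}`. -/
def Dn (n : ℕ) : C := equalizer ((𝟙 R) ^ (n + 1)) (0 : R ⟶ R)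

/-- The inclusion `D_n ⊆ R`. -/
def dnι (n : ℕ) : Dn R n ⟶ R := equalizer.ι ((𝟙 R) ^ (n + 1)) (0 : R ⟶ R)

instance (n : ℕ) : Mono (dnι R n) := inferInstanceAs (Mono (equalizer.ι _ _))

lemma pow_eq {X : C} (a : X ⟶ R) (n : ℕ) : a ≫ (𝟙 R) ^ n = a ^ n := by
  have := map_pow (precomp R a) (𝟙 R) n
  simpa [precomp] using this

lemma dnι_pow (n : ℕ) : (dnι R n) ^ (n + 1) = 0 := by
  have h : dnι R n ≫ (𝟙 R) ^ (n + 1) = dnι R n ≫ (0 : R ⟶ R) := equalizer.condition _ _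
  rw [pow_eq] at h
  rw [h]
  exact map_zero (precomp R (dnι R n))

variable {R}

lemma comp_dnι_pow {X : C} {n : ℕ} (f : X ⟶ Dn R n) : (f ≫ dnι R n) ^ (n + 1) = 0 := by
  have := map_pow (precomp R f) (dnι R n) (n + 1)
  rw [dnι_pow, map_zero] at this
  exact this.symm

/-- The generalized element of `D_n` given by an element `a` of `R` with `a ^ (n + 1) = 0`. -/
def dnLift {X : C} {n : ℕ} (a : X ⟶ R) (h : a ^ (n + 1) = 0) : X ⟶ Dn R n :=
  equalizer.lift a (by
    rw [pow_eq, h]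
    exact (map_zero (precomp R a)).symm)

@[simp]
lemma dnLift_ι {X : C} {n : ℕ} (a : X ⟶ R) (h : a ^ (n + 1) = 0) :
    dnLift a h ≫ dnι R n = a := equalizer.lift_ι _ _

@[simp]
lemma dnLift_ι_assoc {X Z : C} {n : ℕ} (a : X ⟶ R) (h : a ^ (n + 1) = 0) (f : R ⟶ Z) :
    dnLift a h ≫ dnι R n ≫ f = a ≫ f := by rw [← Category.assoc, dnLift_ι]

variable (R)

/-- The object `D = {d ∈ R | d ^ 2 = 0}`. -/
abbrev D : C := Dn R 1

variable {R} in
lemma comp_dι_mul_self {X : C} (f : X ⟶ D R) : (f ≫ dnι R 1) * (f ≫ dnι R 1) = 0 := by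
  rw [← pow_two]; exact comp_dnι_pow f

variable {R} in
/-- The generalized element of `D` given by an element of `R` of square zero. -/
def dLift {X : C} (a : X ⟶ R) (h : a * a = 0) : X ⟶ D R :=
  dnLift a (by rw [one_add_one_eq_two, pow_two]; exact h)

variable {R} in
@[simp]
lemma dLift_ι {X : C} (a : X ⟶ R) (h : a * a = 0) : dLift a h ≫ dnι R 1 = a := dnLift_ι _ _

variable {R} in
@[simp]
lemma dLift_ι_assoc {X Z : C} (a : X ⟶ R) (h : a * a = 0) (f : R ⟶ Z) :
    dLift a h ≫ dnι R 1 ≫ f = a ≫ f := by rw [← Category.assoc, dLift_ι]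

variable {R} in
lemma d_ext {X : C} {f g : X ⟶ D R} (h : f ≫ dnι R 1 = g ≫ dnι R 1) : f = g :=
  (cancel_mono _).1 h

/-- The element `0` of `D`. -/
def zeroD : 𝟙_ C ⟶ D R := dLift 0 (by simp)

/-- The operation `d ↦ -d` on `D`. -/
def negD : D R ⟶ D R := dLift (-dnι R 1) (by
  have := comp_dι_mul_self (𝟙 (D R))
  simpa using this)

/-- The multiplication `(d₁, d₂) ↦ d₁ d₂` from `D × D` to `D`. -/
def mulD : D R ⊗ D R ⟶ D R :=
  dLift ((fst _ _ ≫ dnι R 1) * (snd _ _ ≫ dnι R 1)) (by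
    rw [mul_mul_mul_comm, comp_dι_mul_self, zero_mul])

/-- The multiplication `(d, a) ↦ a d` from `D × R` to `D`. -/
def smulD : D R ⊗ R ⟶ D R :=
  dLift (snd _ _ * (fst _ _ ≫ dnι R 1)) (by
    rw [mul_mul_mul_comm, comp_dι_mul_self, mul_zero])

/-- The object `D(2) = {(d₁, d₂) ∈ D × D | d₁ d₂ = 0}`. -/
def D2 : C := equalizer ((fst (D R) (D R) ≫ dnι R 1) * (snd (D R) (D R) ≫ dnι R 1)) 0

/-- The inclusion `D(2) ⊆ D × D`. -/
def d2ι : D2 R ⟶ D R ⊗ D R := equalizer.ι _ _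

instance : Mono (d2ι R) := inferInstanceAs (Mono (equalizer.ι _ _))

variable {R} in
/-- The generalized element of `D(2)` given by two elements of `D` with product zero. -/
def d2Lift {X : C} (a b : X ⟶ D R) (h : (a ≫ dnι R 1) * (b ≫ dnι R 1) = 0) : X ⟶ D2 R :=
  equalizer.lift (lift a b) (by
    rw [MonObj.comp_mul, lift_fst_assoc, lift_snd_assoc, h]
    exact (map_zero (precomp R _)).symm)

variable {R} in
@[simp]
lemma d2Lift_ι {X : C} (a b : X ⟶ D R) (h : (a ≫ dnι R 1) * (b ≫ dnι R 1) = 0) :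
    d2Lift a b h ≫ d2ι R = lift a b := equalizer.lift_ι _ _

variable {R} in
@[simp]
lemma d2Lift_ι_assoc {X Z : C} (a b : X ⟶ D R) (h : (a ≫ dnι R 1) * (b ≫ dnι R 1) = 0)
    (f : D R ⊗ D R ⟶ Z) : d2Lift a b h ≫ d2ι R ≫ f = lift a b ≫ f := by
  rw [← Category.assoc, d2Lift_ι]

lemma d2_mul : ((d2ι R ≫ fst _ _) ≫ dnι R 1) * ((d2ι R ≫ snd _ _) ≫ dnι R 1) = 0 := by
  have h : d2ι R ≫ ((fst (D R) (D R) ≫ dnι R 1) * (snd (D R) (D R) ≫ dnι R 1)) = d2ι R ≫ 0 :=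
    equalizer.condition _ _
  rw [MonObj.comp_mul] at h
  simp only [Category.assoc]
  rw [h]
  exact map_zero (precomp R _)

lemma zeroD_ι {X : C} : (toUnit X ≫ zeroD R) ≫ dnι R 1 = 0 := by
  rw [Category.assoc, zeroD, dLift_ι]
  exact map_zero (precomp R _)

/-- The axis `d ↦ (d, 0)` of `D(2)`. -/
def d2Inl : D R ⟶ D2 R := d2Lift (𝟙 _) (toUnit _ ≫ zeroD R) (by rw [zeroD_ι, mul_zero])

/-- The axis `d ↦ (0, d)` of `D(2)`. -/
def d2Inr : D R ⟶ D2 R := d2Lift (toUnit _ ≫ zeroD R) (𝟙 _) (by rw [zeroD_ι, zero_mul])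

/-- The diagonal `d ↦ (d, d)` of `D(2)`. -/
def d2Diag : D R ⟶ D2 R := d2Lift (𝟙 _) (𝟙 _) (comp_dι_mul_self _)

end Infinitesimals

section Representability

variable {k : Type w} [Field k]
variable {C : Type u} [Category.{v} C] [CartesianMonoidalCategory C] [BraidedCategory C]
  [HasFiniteLimits C] (R : C) [CommRingObj R] [AlgebraObj k R]

/-- The generic point of `k[ε]`, with values in the functions on `D`. -/
def genD : DualNumber k →ₐ[k] (D R ⟶ R) :=
  DualNumber.lift ⟨(Algebra.ofId k _, dnι R 1), by
    simpa using comp_dι_mul_self (𝟙 (D R)), fun _ => Commute.all _ _⟩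

@[simp] lemma genD_eps : genD (k := k) R DualNumber.eps = dnι R 1 :=
  DualNumber.lift_apply_eps _

lemma isSpec_genD : IsSpec (genD (k := k) R) := by
  intro X h
  refine ⟨dLift (h DualNumber.eps) (by rw [← map_mul, DualNumber.eps_mul_eps, map_zero]), ?_, ?_⟩
  · refine DualNumber.algHom_ext ?_
    simp
  · intro f hf
    refine d_ext ?_
    rw [dLift_ι, ← hf]
    simp

/-- The generic point of `k`. -/
lemma isSpec_unit : IsSpec (Algebra.ofId k (𝟙_ C ⟶ R)) := fun _ _ =>
  ⟨toUnit _, Subsingleton.elim _ _, fun _ _ => toUnit_unique _ _⟩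

/-- The generic point of `k[ε₁, ε₂]`, with values in the functions on `D × D`. -/
def genDD : DualNumber (DualNumber k) →ₐ[k] (D R ⊗ D R ⟶ R) :=
  DualNumber.lift ⟨((pullback k R (fst _ _)).comp (genD R), snd _ _ ≫ dnι R 1),
    comp_dι_mul_self _, fun _ => Commute.all _ _⟩

lemma genDD_inl (x : DualNumber k) :
    genDD (k := k) R (TrivSqZeroExt.inl x) = fst _ _ ≫ genD R x :=
  DualNumber.lift_apply_inl _ _

lemma genDD_eps : genDD (k := k) R DualNumber.eps = snd _ _ ≫ dnι R 1 :=
  DualNumber.lift_apply_eps _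

lemma algHom_ext_DD {A : Type*} [CommRing A] [Algebra k A]
    {f g : DualNumber (DualNumber k) →ₐ[k] A}
    (h₁ : f (TrivSqZeroExt.inl DualNumber.eps) = g (TrivSqZeroExt.inl DualNumber.eps))
    (h₂ : f DualNumber.eps = g DualNumber.eps) : f = g := by
  have h : f.comp (TrivSqZeroExt.inlAlgHom _ _ _) = g.comp (TrivSqZeroExt.inlAlgHom _ _ _) :=
    DualNumber.algHom_ext h₁
  refine DualNumber.algHom_ext' h (LinearMap.ext fun x => ?_)
  have hx : x • (DualNumber.eps : DualNumber (DualNumber k)) =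
      TrivSqZeroExt.inl x * DualNumber.eps := by
    ext <;> simp
  change f (x • DualNumber.eps) = g (x • DualNumber.eps)
  rw [hx, map_mul, map_mul, h₂]
  exact congrArg (· * _) (DFunLike.congr_fun h x)

lemma isSpec_genDD : IsSpec (W := DualNumber (DualNumber k)) (genDD R) := by
  intro X h
  have e : (DualNumber.eps : DualNumber k) * DualNumber.eps = 0 := DualNumber.eps_mul_eps
  refine ⟨lift
    (dLift (h (TrivSqZeroExt.inl DualNumber.eps)) (by
      rw [← map_mul, TrivSqZeroExt.inl_mul_inl, e, TrivSqZeroExt.inl_zero, map_zero]))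
    (dLift (h DualNumber.eps) (by rw [← map_mul, DualNumber.eps_mul_eps, map_zero])), ?_, ?_⟩
  · refine algHom_ext_DD ?_ ?_
    · simp [genDD_inl]
    · simp [genDD_eps]
  · intro f hf
    refine CartesianMonoidalCategory.hom_ext _ _ (d_ext ?_) (d_ext ?_)
    · rw [lift_fst, dLift_ι, ← hf]
      simp [genDD_inl]
    · rw [lift_snd, dLift_ι, ← hf]
      simp [genDD_eps]

/-- The generic point of `k ⊕ k²`, with values in the functions on `D(2)`. -/
def genD2 : TrivSqZeroExt k (k × k) →ₐ[k] (D2 R ⟶ R) :=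
  TrivSqZeroExt.liftEquivOfComm
    ⟨(LinearMap.toSpanSingleton k _ ((d2ι R ≫ fst _ _) ≫ dnι R 1)).coprod
      (LinearMap.toSpanSingleton k _ ((d2ι R ≫ snd _ _) ≫ dnι R 1)), by
      rintro ⟨a, b⟩ ⟨c, d⟩
      have h1 := comp_dι_mul_self (d2ι R ≫ fst _ _)
      have h2 := comp_dι_mul_self (d2ι R ≫ snd _ _)
      have h3 := d2_mul R
      have h4 := d2_mul R
      rw [mul_comm] at h4
      simp only [LinearMap.coprod_apply, LinearMap.toSpanSingleton_apply, add_mul, mul_add,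
        smul_mul_smul_comm, h1, h2, h3, h4, smul_zero, add_zero]⟩

lemma genD2_inr (a b : k) : genD2 (k := k) R (TrivSqZeroExt.inr (a, b)) =
    a • ((d2ι R ≫ fst _ _) ≫ dnι R 1) + b • ((d2ι R ≫ snd _ _) ≫ dnι R 1) := by
  simp [genD2]

lemma algHom_ext_D2 {A : Type*} [CommRing A] [Algebra k A]
    {f g : TrivSqZeroExt k (k × k) →ₐ[k] A}
    (h₁ : f (TrivSqZeroExt.inr (1, 0)) = g (TrivSqZeroExt.inr (1, 0)))
    (h₂ : f (TrivSqZeroExt.inr (0, 1)) = g (TrivSqZeroExt.inr (0, 1))) : f = g := by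
  refine TrivSqZeroExt.algHom_ext ?_
  rintro ⟨a, b⟩
  have : (TrivSqZeroExt.inr (a, b) : TrivSqZeroExt k (k × k)) =
      a • TrivSqZeroExt.inr (1, 0) + b • TrivSqZeroExt.inr (0, 1) := by
    ext <;> simp
  rw [this, map_add, map_add, map_smul, map_smul, map_smul, map_smul, h₁, h₂]

lemma isSpec_genD2 : IsSpec (genD2 (k := k) R) := by
  intro X h
  have e (x y : k × k) : h (TrivSqZeroExt.inr x) * h (TrivSqZeroExt.inr y) = 0 := by
    rw [← map_mul, TrivSqZeroExt.inr_mul_inr, map_zero]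
  refine ⟨d2Lift (dLift (h (TrivSqZeroExt.inr (1, 0))) (e _ _))
    (dLift (h (TrivSqZeroExt.inr (0, 1))) (e _ _)) (by rw [dLift_ι, dLift_ι, e]), ?_, ?_⟩
  · refine algHom_ext_D2 ?_ ?_
    · simp [genD2_inr]
    · simp [genD2_inr]
  · intro f hf
    refine (cancel_mono (d2ι R)).1 ?_
    rw [d2Lift_ι]
    refine CartesianMonoidalCategory.hom_ext _ _ (d_ext ?_) (d_ext ?_)
    · rw [lift_fst, dLift_ι, ← hf]
      simp [genD2_inr]
    · rw [lift_snd, dLift_ι, ← hf]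
      simp [genD2_inr]

end Representability

section Pullback

variable {k : Type w} [Field k]

/-- An unbundled Weil algebra as an object of the category. -/
abbrev WeilAlg.of (W : Type w) [CommRing W] [Algebra k W] (h : IsWeilAlgebra k W) : WeilAlg k :=
  ⟨CommAlgCat.of k W, h⟩

/-- An algebra homomorphism as a morphism of Weil algebras. -/
abbrev WeilAlg.ofHom {W W' : Type w} [CommRing W] [Algebra k W] [CommRing W'] [Algebra k W']
    (h : IsWeilAlgebra k W) (h' : IsWeilAlgebra k W') (φ : W →ₐ[k] W') :
    WeilAlg.of W h ⟶ WeilAlg.of W' h' :=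
  ObjectProperty.homMk (CommAlgCat.ofHom φ)

variable {W₀ W₁ W₂ W₃ : Type w} [CommRing W₀] [CommRing W₁] [CommRing W₂] [CommRing W₃]
  [Algebra k W₀] [Algebra k W₁] [Algebra k W₂] [Algebra k W₃]
  {p : W₀ →ₐ[k] W₁} {q : W₀ →ₐ[k] W₂} {f : W₁ →ₐ[k] W₃} {g : W₂ →ₐ[k] W₃}

/-- A square of algebras which is a pullback of sets is a pullback of algebras. -/
lemma isLimit_of_existsUnique (hw : CommAlgCat.ofHom p ≫ CommAlgCat.ofHom f =
      CommAlgCat.ofHom q ≫ CommAlgCat.ofHom g)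
    (hp : ∀ a b, f a = g b → ∃! c, p c = a ∧ q c = b) :
    Nonempty (IsLimit (PullbackCone.mk (CommAlgCat.ofHom p) (CommAlgCat.ofHom q) hw)) := by
  have inj : ∀ c c', p c = p c' → q c = q c' → c = c' := by
    intro c c' h₁ h₂
    have := DFunLike.congr_fun (congrArg CommAlgCat.Hom.hom hw) c'
    exact (hp (p c') (q c') this).unique ⟨h₁, h₂⟩ ⟨rfl, rfl⟩
  have ex : ∀ {A : CommAlgCat.{w} k} (s : A ⟶ CommAlgCat.of k W₁) (t : A ⟶ CommAlgCat.of k W₂),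
      s ≫ CommAlgCat.ofHom f = t ≫ CommAlgCat.ofHom g →
      ∃ l : A ⟶ CommAlgCat.of k W₀, l ≫ CommAlgCat.ofHom p = s ∧ l ≫ CommAlgCat.ofHom q = t := by
    intro A s t h
    have h' : ∀ a : A, f (s.hom a) = g (t.hom a) := fun a =>
      DFunLike.congr_fun (congrArg CommAlgCat.Hom.hom h) a
    choose c hc using fun a => (hp _ _ (h' a)).exists
    refine ⟨CommAlgCat.ofHom
      { toFun := c
        map_one' := inj _ _ (by simp [hc]) (by simp [hc])
        map_mul' := fun a b => inj _ _ (by simp [hc]) (by simp [hc])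
        map_zero' := inj _ _ (by simp [hc]) (by simp [hc])
        map_add' := fun a b => inj _ _ (by simp [hc]) (by simp [hc])
        commutes' := fun r => inj _ _ (by simp [hc]) (by simp [hc]) }, ?_, ?_⟩
    · ext a
      exact (hc a).1
    · ext a
      exact (hc a).2
  exact ⟨PullbackCone.IsLimit.mk hw (fun s => (ex s.fst s.snd s.condition).choose)
    (fun s => (ex s.fst s.snd s.condition).choose_spec.1)
    (fun s => (ex s.fst s.snd s.condition).choose_spec.2)
    (fun s m h₁ h₂ => by
      have h₃ := (ex s.fst s.snd s.condition).choose_spec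
      ext a
      refine inj _ _ ?_ ?_
      · exact DFunLike.congr_fun (congrArg CommAlgCat.Hom.hom (h₁.trans h₃.1.symm)) a
      · exact DFunLike.congr_fun (congrArg CommAlgCat.Hom.hom (h₂.trans h₃.2.symm)) a)⟩

variable {C : Type u} [Category.{v} C] [CartesianMonoidalCategory C] [BraidedCategory C]
  [HasFiniteLimits C] {R : C} [CommRingObj R] [AlgebraObj k R] [MonoidalClosed C]

lemma curry_specExp_map {M X : C} {W W' : WeilAlg k} (φ : W ⟶ W') (m : Spec R W ⊗ X ⟶ M) :
    MonoidalClosed.curry m ≫ (specExp R M).map φ =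
      MonoidalClosed.curry (specMap R φ ▷ X ≫ m) :=
  MonoidalClosed.curry_pre_app (specMap R φ) m

/-- The defining property of microlinear objects, for a pullback square of Weil algebras and on
generalized elements. -/
lemma Microlinear.existsUnique {M : C} (hM : Microlinear k R M)
    (h₀ : IsWeilAlgebra k W₀) (h₁ : IsWeilAlgebra k W₁) (h₂ : IsWeilAlgebra k W₂)
    (h₃ : IsWeilAlgebra k W₃) (hw : f.comp p = g.comp q)
    (hp : ∀ a b, f a = g b → ∃! c, p c = a ∧ q c = b)
    {S₀ S₁ S₂ S₃ : C} {g₀ : W₀ →ₐ[k] (S₀ ⟶ R)} {g₁ : W₁ →ₐ[k] (S₁ ⟶ R)}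
    {g₂ : W₂ →ₐ[k] (S₂ ⟶ R)} {g₃ : W₃ →ₐ[k] (S₃ ⟶ R)}
    (s₀ : IsSpec g₀) (s₁ : IsSpec g₁) (s₂ : IsSpec g₂) (s₃ : IsSpec g₃)
    {sp : S₁ ⟶ S₀} {sq : S₂ ⟶ S₀} {sf : S₃ ⟶ S₁} {sg : S₃ ⟶ S₂}
    (hsp : (pullback k R sp).comp g₀ = g₁.comp p) (hsq : (pullback k R sq).comp g₀ = g₂.comp q)
    (hsf : (pullback k R sf).comp g₁ = g₃.comp f) (hsg : (pullback k R sg).comp g₂ = g₃.comp g)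
    {X : C} (m₁ : S₁ ⊗ X ⟶ M) (m₂ : S₂ ⊗ X ⟶ M) (hm : sf ▷ X ≫ m₁ = sg ▷ X ≫ m₂) :
    ∃! m : S₀ ⊗ X ⟶ M, sp ▷ X ≫ m = m₁ ∧ sq ▷ X ≫ m = m₂ := by
  have comparison : ∀ {W : Type w} [CommRing W] [Algebra k W] (h : IsWeilAlgebra k W) {S : C}
      {g : W →ₐ[k] (S ⟶ R)} (s : IsSpec g), ∃ i : Spec R (WeilAlg.of W h) ≅ S,
        (pullback k R i.hom).comp g = specGen R (WeilAlg.of W h) ∧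
        (pullback k R i.inv).comp (specGen R (WeilAlg.of W h)) = g := by
    intro W _ _ h S g s
    have s' : IsSpec (W := W) (specGen R (WeilAlg.of W h)) := isSpec_specGen (WeilAlg.of W h)
    refine ⟨⟨s.lift (specGen R (WeilAlg.of W h)), s'.lift g, ?_, ?_⟩, s.lift_spec _, s'.lift_spec _⟩
    · refine s'.hom_ext ?_
      rw [pullback_comp, AlgHom.comp_assoc, s'.lift_spec, s.lift_spec, pullback_id]
      rfl
    · refine s.hom_ext ?_
      rw [pullback_comp, AlgHom.comp_assoc, s.lift_spec, s'.lift_spec, pullback_id]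
      rfl
  obtain ⟨i₀, a₀, b₀⟩ := comparison h₀ s₀
  obtain ⟨i₁, a₁, b₁⟩ := comparison h₁ s₁
  obtain ⟨i₂, a₂, b₂⟩ := comparison h₂ s₂
  obtain ⟨i₃, a₃, b₃⟩ := comparison h₃ s₃
  have square : ∀ {W W' : Type w} [CommRing W] [Algebra k W] [CommRing W'] [Algebra k W']
      (h : IsWeilAlgebra k W) (h' : IsWeilAlgebra k W') {S S' : C}
      {g : W →ₐ[k] (S ⟶ R)} {g' : W' →ₐ[k] (S' ⟶ R)} (s : IsSpec g)
      (i : Spec R (WeilAlg.of W h) ≅ S) (i' : Spec R (WeilAlg.of W' h') ≅ S')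
      (a : (pullback k R i.hom).comp g = specGen R (WeilAlg.of W h))
      (a' : (pullback k R i'.hom).comp g' = specGen R (WeilAlg.of W' h'))
      (φ : W →ₐ[k] W') (t : S' ⟶ S) (ht : (pullback k R t).comp g = g'.comp φ),
      specMap R (WeilAlg.ofHom h h' φ) ≫ i.hom = i'.hom ≫ t := by
    intro W W' _ _ _ _ h h' S S' g g' s i i' a a' φ t ht
    refine s.hom_ext ?_
    rw [pullback_comp, AlgHom.comp_assoc, a, pullback_comp, AlgHom.comp_assoc, ht,
      ← AlgHom.comp_assoc, a']
    exact specMap_spec R (WeilAlg.ofHom h h' φ)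
  have qp := square h₀ h₁ s₀ i₀ i₁ a₀ a₁ p sp hsp
  have qq := square h₀ h₂ s₀ i₀ i₂ a₀ a₂ q sq hsq
  have qf := square h₁ h₃ s₁ i₁ i₃ a₁ a₃ f sf hsf
  have qg := square h₂ h₃ s₂ i₂ i₃ a₂ a₃ g sg hsg
  have hw' : WeilAlg.ofHom h₀ h₁ p ≫ WeilAlg.ofHom h₁ h₃ f =
      WeilAlg.ofHom h₀ h₂ q ≫ WeilAlg.ofHom h₂ h₃ g := by
    ext x
    exact DFunLike.congr_fun hw x
  obtain ⟨lim⟩ := hM WalkingCospan _ (PullbackCone.mk _ _ hw') (by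
    obtain ⟨l⟩ := isLimit_of_existsUnique (p := p) (q := q) (f := f) (g := g)
      (congrArg CommAlgCat.ofHom hw) hp
    exact ⟨(isLimitMapConePullbackConeEquiv (ObjectProperty.ι _) hw').symm l⟩)
  have lim' := isLimitMapConePullbackConeEquiv (specExp R M) hw' lim
  have hm' : MonoidalClosed.curry (i₁.hom ▷ X ≫ m₁) ≫ (specExp R M).map (WeilAlg.ofHom h₁ h₃ f) =
      MonoidalClosed.curry (i₂.hom ▷ X ≫ m₂) ≫ (specExp R M).map (WeilAlg.ofHom h₂ h₃ g) := by
    rw [curry_specExp_map, curry_specExp_map, ← comp_whiskerRight_assoc, ← comp_whiskerRight_assoc,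
      qf, qg, comp_whiskerRight_assoc, comp_whiskerRight_assoc, hm]
  have back : ∀ {S : C} {W : Type w} [CommRing W] [Algebra k W] (h : IsWeilAlgebra k W)
      (φ : W₀ →ₐ[k] W) (i : Spec R (WeilAlg.of W h) ≅ S) (t : S ⟶ S₀)
      (_ : specMap R (WeilAlg.ofHom h₀ h φ) ≫ i₀.hom = i.hom ≫ t) (n : S ⊗ X ⟶ M)
      (l : Spec R (WeilAlg.of W₀ h₀) ⊗ X ⟶ M),
      MonoidalClosed.curry l ≫ (specExp R M).map (WeilAlg.ofHom h₀ h φ) =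
        MonoidalClosed.curry (i.hom ▷ X ≫ n) ↔ t ▷ X ≫ i₀.inv ▷ X ≫ l = n := by
    intro S W _ _ h φ i t ht n l
    rw [curry_specExp_map]
    refine MonoidalClosed.curry_injective.eq_iff.trans ?_
    rw [← cancel_epi (i.hom ▷ X) (g := t ▷ X ≫ _), ← comp_whiskerRight_assoc, ← ht,
      comp_whiskerRight_assoc, hom_inv_whiskerRight_assoc]
  obtain ⟨l, hl⟩ : ∃ l, MonoidalClosed.curry l = PullbackCone.IsLimit.lift lim' _ _ hm' :=
    ⟨_, MonoidalClosed.curry_uncurry _⟩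
  have l₁ := PullbackCone.IsLimit.lift_fst lim' _ _ hm'
  have l₂ := PullbackCone.IsLimit.lift_snd lim' _ _ hm'
  rw [← hl] at l₁ l₂
  refine ⟨i₀.inv ▷ X ≫ l, ⟨(back h₁ p i₁ sp qp _ _).1 l₁, (back h₂ q i₂ sq qq _ _).1 l₂⟩, ?_⟩
  rintro m ⟨e₁, e₂⟩
  have key : MonoidalClosed.curry (i₀.hom ▷ X ≫ m) = MonoidalClosed.curry l := by
    refine PullbackCone.IsLimit.hom_ext lim' ?_ ?_
    · refine Eq.trans ((back h₁ p i₁ sp qp m₁ _).2 ?_) l₁.symm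
      rw [inv_hom_whiskerRight_assoc, e₁]
    · refine Eq.trans ((back h₂ q i₂ sq qq m₂ _).2 ?_) l₂.symm
      rw [inv_hom_whiskerRight_assoc, e₂]
  rw [← MonoidalClosed.curry_injective key, inv_hom_whiskerRight_assoc]

end Pullback

section Microlinearity

variable (k : Type w) [Field k]

lemma isWeilAlgebra_self : IsWeilAlgebra k k :=
  ⟨inferInstance, AlgHom.id k k, 1, by
    rw [pow_one]; exact (RingHom.injective_iff_ker_eq_bot _).1 fun _ _ h => h⟩

lemma isWeilAlgebra_of_nilpotent (W : Type w) [CommRing W] [Algebra k W] [Module.Finite k W]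
    (π : W →ₐ[k] k) (h : ∀ x, π x = 0 → IsNilpotent x) : IsWeilAlgebra k W := by
  have := IsNoetherianRing.of_finite k W
  refine ⟨inferInstance, π, ?_⟩
  rw [Ideal.FG.isNilpotent_iff_le_nilradical (IsNoetherian.noetherian _)]
  exact fun x hx => h x hx

instance finite_tsze (V : Type w) [AddCommGroup V] [Module k V] [Module.Finite k V] :
    Module.Finite k (TrivSqZeroExt k V) := inferInstanceAs (Module.Finite k (k × V))

lemma isWeilAlgebra_tsze (V : Type w) [AddCommGroup V] [Module k V] [Module kᵐᵒᵖ V]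
    [IsCentralScalar k V] [Module.Finite k V] : IsWeilAlgebra k (TrivSqZeroExt k V) := by
  refine isWeilAlgebra_of_nilpotent k _ (TrivSqZeroExt.fstHom k k V) fun x hx => ⟨2, ?_⟩
  change x.fst = 0 at hx
  ext <;> simp [pow_two, hx]

lemma isWeilAlgebra_dual₂ : IsWeilAlgebra k (DualNumber (DualNumber k)) := by
  have : Module.Finite k (DualNumber (DualNumber k)) :=
    inferInstanceAs (Module.Finite k (DualNumber k × DualNumber k))
  refine isWeilAlgebra_of_nilpotent k _ ((TrivSqZeroExt.fstHom k k k).comp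
    (TrivSqZeroExt.fstHom k (DualNumber k) (DualNumber k))) fun x hx => ⟨3, ?_⟩
  change x.fst.fst = 0 at hx
  ext <;> simp [pow_succ, hx]

/-- The square of `k`-algebras with `k ⊕ k² = k[ε] ×ₖ k[ε]`. -/
lemma pullback_D2 (a b : DualNumber k)
    (h : TrivSqZeroExt.fstHom k k k a = TrivSqZeroExt.fstHom k k k b) :
    ∃! c : TrivSqZeroExt k (k × k), TrivSqZeroExt.map (LinearMap.fst k k k) c = a ∧
      TrivSqZeroExt.map (LinearMap.snd k k k) c = b := by
  change a.fst = b.fst at h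
  refine ⟨TrivSqZeroExt.inl a.fst + TrivSqZeroExt.inr (a.snd, b.snd), ⟨?_, ?_⟩, ?_⟩
  · ext <;> simp
  · ext <;> simp [h]
  · rintro c ⟨rfl, rfl⟩
    ext <;> simp

/-- Restriction to `D(2)` of the functions on `D × D`. -/
def resDD : DualNumber (DualNumber k) →ₐ[k] TrivSqZeroExt k (k × k) :=
  DualNumber.lift ⟨(TrivSqZeroExt.map (LinearMap.inl k k k), TrivSqZeroExt.inr (0, 1)),
    TrivSqZeroExt.inr_mul_inr _ _ _, fun _ => Commute.all _ _⟩

/-- The map of function algebras induced by the multiplication `D × D ⟶ D`. -/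
def mulDD : DualNumber k →ₐ[k] DualNumber (DualNumber k) :=
  DualNumber.lift ⟨(Algebra.ofId k _, TrivSqZeroExt.inr DualNumber.eps),
    TrivSqZeroExt.inr_mul_inr _ _ _, fun _ => Algebra.commute_algebraMap_right _ _⟩

lemma resDD_apply (a : DualNumber (DualNumber k)) :
    resDD k a = TrivSqZeroExt.inl a.fst.fst + TrivSqZeroExt.inr (a.fst.snd, a.snd.fst) := by
  have h : resDD k a = TrivSqZeroExt.map (LinearMap.inl k k k) a.fst +
      TrivSqZeroExt.map (LinearMap.inl k k k) a.snd * TrivSqZeroExt.inr (0, 1) :=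
    DualNumber.lift_apply_apply _ _
  rw [h]
  ext <;> simp

lemma mulDD_apply (c : DualNumber k) : mulDD k c =
    TrivSqZeroExt.inl (TrivSqZeroExt.inl c.fst) + TrivSqZeroExt.inr (TrivSqZeroExt.inr c.snd) := by
  have h : mulDD k c = algebraMap k (DualNumber (DualNumber k)) c.fst +
      algebraMap k (DualNumber (DualNumber k)) c.snd * TrivSqZeroExt.inr DualNumber.eps :=
    DualNumber.lift_apply_apply _ _
  simp only [h, TrivSqZeroExt.algebraMap_eq_inl']
  ext <;> simp

lemma mulDD_eps : mulDD k DualNumber.eps =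
    TrivSqZeroExt.inl DualNumber.eps * DualNumber.eps := by
  rw [mulDD_apply]
  ext <;> simp

lemma resDD_inl_eps : resDD k (TrivSqZeroExt.inl DualNumber.eps) = TrivSqZeroExt.inr (1, 0) := by
  rw [resDD_apply]
  ext <;> simp

lemma resDD_eps : resDD k DualNumber.eps = TrivSqZeroExt.inr (0, 1) := by
  rw [resDD_apply]
  ext <;> simp

lemma pullback_DD (a : DualNumber (DualNumber k)) (b : k)
    (h : resDD k a = Algebra.ofId k (TrivSqZeroExt k (k × k)) b) :
    ∃! c : DualNumber k, mulDD k c = a ∧ TrivSqZeroExt.fstHom k k k c = b := by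
  rw [resDD_apply, Algebra.ofId_apply, TrivSqZeroExt.algebraMap_eq_inl] at h
  have h₀ : a.fst.fst = b := by simpa using congrArg TrivSqZeroExt.fst h
  have h₁ : (a.fst.snd, a.snd.fst) = (0 : k × k) := by simpa using congrArg TrivSqZeroExt.snd h
  have h₂ : a.fst.snd = 0 := congrArg Prod.fst h₁
  have h₃ : a.snd.fst = 0 := congrArg Prod.snd h₁
  refine ⟨TrivSqZeroExt.inl b + TrivSqZeroExt.inr a.snd.snd, ⟨?_, by simp⟩, ?_⟩
  · rw [mulDD_apply]
    ext <;> simp [h₀, h₂, h₃]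
  · rintro c ⟨rfl, rfl⟩
    rw [mulDD_apply]
    ext <;> simp

variable {k}
variable {C : Type u} [Category.{v} C] [CartesianMonoidalCategory C] [BraidedCategory C]
  [HasFiniteLimits C] {R : C} [CommRingObj R] [AlgebraObj k R] [MonoidalClosed C]

lemma Microlinear.d2 {M : C} (hM : Microlinear k R M) {X : C} (t₁ t₂ : D R ⊗ X ⟶ M)
    (h : zeroD R ▷ X ≫ t₁ = zeroD R ▷ X ≫ t₂) :
    ∃! l : D2 R ⊗ X ⟶ M, d2Inl R ▷ X ≫ l = t₁ ∧ d2Inr R ▷ X ≫ l = t₂ := by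
  have z : zeroD R ≫ dnι R 1 = 0 := dLift_ι _ _
  have z' : toUnit (D R) ≫ zeroD R ≫ dnι R 1 = 0 := by
    rw [← Category.assoc]; exact zeroD_ι R
  refine hM.existsUnique (isWeilAlgebra_tsze k (k × k)) (isWeilAlgebra_tsze k k)
    (isWeilAlgebra_tsze k k) (isWeilAlgebra_self k) ?_ (pullback_D2 k) (isSpec_genD2 R)
    (isSpec_genD R) (isSpec_genD R) (isSpec_unit R) ?_ ?_ ?_ ?_ t₁ t₂ h
  · ext <;> simp
  · refine algHom_ext_D2 ?_ ?_
    · simp [genD2_inr, d2Inl]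
    · simp [genD2_inr, d2Inl, z']
  · refine algHom_ext_D2 ?_ ?_
    · simp [genD2_inr, d2Inr, z']
    · simp [genD2_inr, d2Inr]
  · refine DualNumber.algHom_ext ?_
    simp [z]
  · refine DualNumber.algHom_ext ?_
    simp [z]

lemma Microlinear.dd {M : C} (hM : Microlinear k R M) {X : C} (m : (D R ⊗ D R) ⊗ X ⟶ M)
    (c : 𝟙_ C ⊗ X ⟶ M) (h : d2ι R ▷ X ≫ m = toUnit _ ▷ X ≫ c) :
    ∃! s : D R ⊗ X ⟶ M, mulD R ▷ X ≫ s = m ∧ zeroD R ▷ X ≫ s = c := by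
  have z : zeroD R ≫ dnι R 1 = 0 := dLift_ι _ _
  refine hM.existsUnique (isWeilAlgebra_tsze k k) (isWeilAlgebra_dual₂ k)
    (isWeilAlgebra_self k) (isWeilAlgebra_tsze k (k × k)) ?_ (pullback_DD k) (isSpec_genD R)
    (isSpec_genDD R) (isSpec_unit R) (isSpec_genD2 R) ?_ ?_ ?_ (Subsingleton.elim _ _) m c h
  · refine DualNumber.algHom_ext ?_
    simp [mulDD_eps, resDD_inl_eps, resDD_eps, TrivSqZeroExt.inr_mul_inr]
  · refine DualNumber.algHom_ext ?_
    simp [mulDD_eps, genDD_inl, genDD_eps, mulD]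
  · refine DualNumber.algHom_ext ?_
    simp [z]
  · exact algHom_ext_DD (by simp [genDD_inl, resDD_inl_eps, genD2_inr])
      (by simp [genDD_eps, resDD_eps, genD2_inr])

end Microlinearity

section Exponentials

variable {C : Type u} [Category.{v} C] [CartesianMonoidalCategory C] [MonoidalClosed C]

/-- The presheaf of groups represented by the exponential `U ⟹ G` of a group object. -/
def expGrpFunctor (U G : C) [GrpObj G] : Cᵒᵖ ⥤ GrpCat.{v} where
  obj X := .of (U ⊗ X.unop ⟶ G)
  map f := GrpCat.ofHom
    { toFun := fun x => U ◁ f.unop ≫ x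
      map_one' := MonObj.comp_one _
      map_mul' := fun _ _ => MonObj.comp_mul _ _ _ }
  map_id X := by
    ext x
    simp
  map_comp f g := by
    ext x
    simp

/-- The exponential `U ⟹ G` of a group object, with the pointwise group structure. -/
instance expGrpObj (U G : C) [GrpObj G] : GrpObj (U ⟹ G) :=
  GrpObj.ofRepresentableBy (U ⟹ G) (expGrpFunctor U G)
    { homEquiv := ⟨MonoidalClosed.uncurry, MonoidalClosed.curry, MonoidalClosed.curry_uncurry,
        MonoidalClosed.uncurry_curry⟩
      homEquiv_comp := fun f g => MonoidalClosed.uncurry_natural_left f g }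

/-- The group structure of `U ⟹ G` is pointwise. -/
lemma uncurry_mul (U G : C) [GrpObj G] {X : C} (x y : X ⟶ (U ⟹ G)) :
    MonoidalClosed.uncurry (x * y) = MonoidalClosed.uncurry x * MonoidalClosed.uncurry y := by
  have hμ : MonObj.mul (X := U ⟹ G) = MonoidalClosed.curry
    ((MonoidalClosed.uncurry (fst _ _) * MonoidalClosed.uncurry (snd _ _) :
      U ⊗ ((U ⟹ G) ⊗ (U ⟹ G)) ⟶ G)) := rfl
  rw [Hom.mul_def, hμ, MonoidalClosed.uncurry_natural_left, MonoidalClosed.uncurry_curry, MonObj.comp_mul,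
    ← MonoidalClosed.uncurry_natural_left, ← MonoidalClosed.uncurry_natural_left, lift_fst,
    lift_snd]

lemma uncurry_one (U G : C) [GrpObj G] {X : C} :
    MonoidalClosed.uncurry (1 : X ⟶ (U ⟹ G)) = 1 := by
  have := uncurry_mul U G (1 : X ⟶ (U ⟹ G)) 1
  simpa using this

/-- The exchange `(a, (b, x)) ↦ (b, (a, x))`. -/
def exchange (U V X : C) : U ⊗ (V ⊗ X) ⟶ V ⊗ (U ⊗ X) :=
  lift (snd _ _ ≫ fst _ _) (lift (fst _ _) (snd _ _ ≫ snd _ _))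

@[simp]
lemma exchange_exchange (U V X : C) : exchange U V X ≫ exchange V U X = 𝟙 _ := by
  refine CartesianMonoidalCategory.hom_ext _ _ ?_ (CartesianMonoidalCategory.hom_ext _ _ ?_ ?_) <;>
    simp [exchange]

@[simp]
lemma exchange_exchange_assoc (U V X : C) {Z : C} (f : U ⊗ (V ⊗ X) ⟶ Z) :
    exchange U V X ≫ exchange V U X ≫ f = f := by
  rw [← Category.assoc, exchange_exchange, Category.id_comp]

lemma exchange_natural {U U' V V' X X' : C} (f : U ⟶ U') (g : V ⟶ V') (h : X ⟶ X') :
    (f ⊗ₘ (g ⊗ₘ h)) ≫ exchange U' V' X' = exchange U V X ≫ (g ⊗ₘ (f ⊗ₘ h)) := by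
  refine CartesianMonoidalCategory.hom_ext _ _ ?_ (CartesianMonoidalCategory.hom_ext _ _ ?_ ?_) <;>
    simp [exchange]

/-- The double transpose `V × (U × X) ⟶ M` of a generalized element of `U ⟹ (V ⟹ M)`. -/
def uncurry₂ {U V M X : C} (x : X ⟶ (U ⟹ (V ⟹ M))) : V ⊗ (U ⊗ X) ⟶ M :=
  MonoidalClosed.uncurry (MonoidalClosed.uncurry x)

lemma uncurry₂_injective {U V M X : C} {x y : X ⟶ (U ⟹ (V ⟹ M))}
    (h : uncurry₂ x = uncurry₂ y) : x = y :=
  MonoidalClosed.uncurry_injective (MonoidalClosed.uncurry_injective h)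

lemma uncurry₂_comp {U V M X Y : C} (f : Y ⟶ X) (x : X ⟶ (U ⟹ (V ⟹ M))) :
    uncurry₂ (f ≫ x) = V ◁ U ◁ f ≫ uncurry₂ x := by
  simp only [uncurry₂, MonoidalClosed.uncurry_natural_left]

/-- The canonical morphism `(M ^ V) ^ U ⟶ (M ^ U) ^ V` of the exponential law, which exchanges
the two arguments. -/
def expSwap (U V M : C) : (U ⟹ (V ⟹ M)) ⟶ (V ⟹ (U ⟹ M)) :=
  MonoidalClosed.curry (MonoidalClosed.curry (exchange U V _ ≫ uncurry₂ (𝟙 _)))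

lemma uncurry₂_expSwap {U V M X : C} (x : X ⟶ (U ⟹ (V ⟹ M))) :
    uncurry₂ (x ≫ expSwap U V M) = exchange U V X ≫ uncurry₂ x := by
  rw [uncurry₂_comp]
  simp only [uncurry₂, expSwap, MonoidalClosed.uncurry_curry]
  change _ = exchange U V X ≫ uncurry₂ x
  rw [← Category.comp_id x, uncurry₂_comp, Category.comp_id]
  have := exchange_natural (𝟙 U) (𝟙 V) x
  simp only [id_tensorHom] at this
  rw [← Category.assoc, this, Category.assoc]
  rfl

@[simp]
lemma expSwap_expSwap (U V M : C) : expSwap U V M ≫ expSwap V U M = 𝟙 _ := by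
  refine uncurry₂_injective ?_
  rw [← Category.id_comp (expSwap U V M), Category.assoc, ← Category.assoc, uncurry₂_expSwap,
    uncurry₂_expSwap, exchange_exchange_assoc]

/-- The exponential law `(M ^ V) ^ U = (M ^ U) ^ V`. -/
@[simps]
def expSwapIso (U V M : C) : (U ⟹ (V ⟹ M)) ≅ (V ⟹ (U ⟹ M)) where
  hom := expSwap U V M
  inv := expSwap V U M

variable {k : Type w} [Field k] [BraidedCategory C]
  [HasFiniteLimits C] {R : C} [CommRingObj R] [AlgebraObj k R]

lemma uncurry₂_pre {U U' V M X : C} (f : U' ⟶ U) (x : X ⟶ (U ⟹ (V ⟹ M))) :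
    uncurry₂ (x ≫ (MonoidalClosed.pre f).app (V ⟹ M)) = V ◁ f ▷ X ≫ uncurry₂ x := by
  rw [uncurry₂, MonoidalClosed.uncurry_pre_app, MonoidalClosed.uncurry_natural_left]
  rfl

lemma uncurry₂_map_pre {U V V' M X : C} (f : V' ⟶ V) (x : X ⟶ (U ⟹ (V ⟹ M))) :
    uncurry₂ (x ≫ (ihom U).map ((MonoidalClosed.pre f).app M)) =
      f ▷ (U ⊗ X) ≫ uncurry₂ x := by
  rw [uncurry₂, MonoidalClosed.uncurry_natural_right, MonoidalClosed.uncurry_pre_app]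
  rfl

variable (k R) in
/-- `W ↦ (M ^ U) ^ (Spec W)` is `W ↦ (M ^ (Spec W)) ^ U`. -/
def specExpIhom (U M : C) : specExp (k := k) R M ⋙ ihom U ≅ specExp (k := k) R (U ⟹ M) :=
  NatIso.ofComponents (fun W => expSwapIso U (Spec R W) M) (fun {W W'} φ => by
    change (ihom U).map ((MonoidalClosed.pre (specMap R φ)).app M) ≫ expSwap U (Spec R W') M =
      expSwap U (Spec R W) M ≫ (MonoidalClosed.pre (specMap R φ)).app (U ⟹ M)
    refine uncurry₂_injective ?_
    rw [uncurry₂_expSwap, uncurry₂_pre, ← Category.id_comp ((ihom U).map _), uncurry₂_map_pre,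
      ← Category.id_comp (expSwap _ _ _), uncurry₂_expSwap]
    have := exchange_natural (𝟙 U) (specMap R φ) (𝟙 (U ⟹ (Spec R W ⟹ M)))
    simp only [id_tensorHom, tensorHom_id, id_whiskerRight] at this
    rw [← Category.assoc, ← Category.assoc, ← this])

/-- Exponentials of microlinear objects are microlinear. -/
lemma Microlinear.exp {M : C} (hM : Microlinear k R M) (U : C) : Microlinear k R (U ⟹ M) := by
  intro J _ _ F c hc
  obtain ⟨l⟩ := hM J F c hc
  exact ⟨IsLimit.mapConeEquiv (specExpIhom k R U M) (isLimitOfPreserves (ihom U) l)⟩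

end Exponentials

section Equalizer

variable {k : Type w} [Field k]
variable {C : Type u} [Category.{v} C] [CartesianMonoidalCategory C] [BraidedCategory C]
  [HasFiniteLimits C] {R : C} [CommRingObj R] [AlgebraObj k R] [MonoidalClosed C]

lemma uncurry_map_injective {U A B X : C} (i : A ⟶ B) [Mono i] {x y : X ⟶ (U ⟹ A)}
    (h : x ≫ (ihom U).map i = y ≫ (ihom U).map i) : x = y := by
  refine MonoidalClosed.uncurry_injective ((cancel_mono i).1 ?_)
  rw [← MonoidalClosed.uncurry_natural_right, ← MonoidalClosed.uncurry_natural_right, h]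

variable (k R) in
/-- Functoriality of `M ^ (Spec W)` in `M`. -/
def specExpMap {A B : C} (f : A ⟶ B) : specExp (k := k) R A ⟶ specExp (k := k) R B where
  app W := (ihom (Spec R W)).map f
  naturality _ _ φ := MonoidalClosed.pre_comm_ihom_map (specMap R φ) f

/-- The equalizer of two morphisms of microlinear objects is microlinear. -/
lemma Microlinear.equalizer {A B : C} (hA : Microlinear k R A) (hB : Microlinear k R B)
    (f g : A ⟶ B) : Microlinear k R (equalizer f g) := by
  intro J _ _ F c hc
  obtain ⟨lA⟩ := hA J F c hc
  obtain ⟨lB⟩ := hB J F c hc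
  let i := equalizer.ι f g
  have nat : ∀ {X E E' : C} (h : E ⟶ E') {W W' : WeilAlg k} (φ : W ⟶ W')
      (m : X ⟶ (Spec R W ⟹ E)), (m ≫ (ihom (Spec R W)).map h) ≫ (specExp R E').map φ =
        (m ≫ (specExp R E).map φ) ≫ (ihom (Spec R W')).map h := by
    intro X E E' h W W' φ m
    exact (Category.assoc _ _ _).trans ((congrArg (m ≫ ·)
      ((specExpMap k R h).naturality φ).symm).trans (Category.assoc _ _ _).symm)
  have hif : ∀ {X S : C} (m : X ⟶ (S ⟹ Limits.equalizer f g)),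
      (m ≫ (ihom S).map i) ≫ (ihom S).map f = (m ≫ (ihom S).map i) ≫ (ihom S).map g := by
    intro X S m
    rw [Category.assoc, Category.assoc, ← Functor.map_comp, ← Functor.map_comp,
      equalizer.condition]
  have factor : ∀ {X S : C} (m : X ⟶ (S ⟹ A)),
      m ≫ (ihom S).map f = m ≫ (ihom S).map g →
      ∃ l : X ⟶ (S ⟹ Limits.equalizer f g), l ≫ (ihom S).map i = m := by
    intro X S m h
    have h' := congrArg MonoidalClosed.uncurry h
    rw [MonoidalClosed.uncurry_natural_right, MonoidalClosed.uncurry_natural_right] at h'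
    exact ⟨MonoidalClosed.curry (equalizer.lift _ h'), by
      rw [← MonoidalClosed.curry_natural_right, equalizer.lift_ι, MonoidalClosed.curry_uncurry]⟩
  have inj : ∀ {X : C} (W : WeilAlg k) (x y : X ⟶ (Spec R W ⟹ Limits.equalizer f g)),
      x ≫ (ihom _).map i = y ≫ (ihom _).map i → x = y :=
    fun W x y h => uncurry_map_injective i h
  have ex : ∀ s : Cone (F ⋙ specExp R (Limits.equalizer f g)),
      ∃ l : s.pt ⟶ (Spec R c.pt ⟹ Limits.equalizer f g),
        ∀ j, l ≫ (specExp R _).map (c.π.app j) = s.π.app j := by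
    intro s
    let sA := (Cone.postcompose (Functor.whiskerLeft F (specExpMap k R i))).obj s
    have hl : ∀ j, lA.lift sA ≫ (specExp R A).map (c.π.app j) =
      s.π.app j ≫ (ihom (Spec R (F.obj j))).map i := fun j => lA.fac sA j
    obtain ⟨l, h⟩ := factor (lA.lift sA) (lB.hom_ext fun j => by
      refine (nat f (c.π.app j) _).trans (Eq.trans ?_ (nat g (c.π.app j) _).symm)
      refine (congrArg (· ≫ (ihom (Spec R (F.obj j))).map f) (hl j)).trans
        (Eq.trans ?_ (congrArg (· ≫ (ihom (Spec R (F.obj j))).map g) (hl j)).symm)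
      exact hif (s.π.app j))
    refine ⟨l, fun j => inj _ _ _ ?_⟩
    refine (nat i (c.π.app j) l).symm.trans (Eq.trans ?_ (hl j))
    exact congrArg (· ≫ (specExp R A).map (c.π.app j)) h
  refine ⟨{
    lift := fun s => (ex s).choose
    fac := fun s j => (ex s).choose_spec j
    uniq := fun s m hm => inj _ _ _ (lA.hom_ext fun j => ?_) }⟩
  refine (nat i (c.π.app j) _).trans (Eq.trans ?_ (nat i (c.π.app j) _).symm)
  exact congrArg (· ≫ (ihom (Spec R (F.obj j))).map i)
    ((hm j).trans ((ex s).choose_spec j).symm)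

end Equalizer

section LieAlgebra

variable {C : Type u} [Category.{v} C] [CartesianMonoidalCategory C]

/-- The operations of an internal Lie algebra over `R`. -/
structure LieOps (R : C) where
  carrier : C
  zero : 𝟙_ C ⟶ carrier
  add : carrier ⊗ carrier ⟶ carrier
  neg : carrier ⟶ carrier
  smul : R ⊗ carrier ⟶ carrier
  bracket : carrier ⊗ carrier ⟶ carrier

namespace LieOps

variable {R : C} (A : LieOps R) {X Y : C}

/-- The zero vector, at stage `X`. -/
def nul (X : C) : X ⟶ A.carrier := toUnit X ≫ A.zero
/-- The sum of generalized elements. -/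
def plus (x y : X ⟶ A.carrier) : X ⟶ A.carrier := lift x y ≫ A.add
/-- The negative of a generalized element. -/
def opp (x : X ⟶ A.carrier) : X ⟶ A.carrier := x ≫ A.neg
/-- The scalar multiple of a generalized element. -/
def scal (a : X ⟶ R) (x : X ⟶ A.carrier) : X ⟶ A.carrier := lift a x ≫ A.smul
/-- The Lie bracket of generalized elements. -/
def brak (x y : X ⟶ A.carrier) : X ⟶ A.carrier := lift x y ≫ A.bracket

lemma comp_nul (f : Y ⟶ X) : f ≫ A.nul X = A.nul Y := by
  rw [nul, nul, ← Category.assoc]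
  congr 1
  exact toUnit_unique _ _

lemma comp_plus (f : Y ⟶ X) (x y : X ⟶ A.carrier) :
    f ≫ A.plus x y = A.plus (f ≫ x) (f ≫ y) := by
  rw [plus, plus, comp_lift_assoc]

lemma comp_opp (f : Y ⟶ X) (x : X ⟶ A.carrier) : f ≫ A.opp x = A.opp (f ≫ x) := by simp [opp]

lemma comp_scal (f : Y ⟶ X) (a : X ⟶ R) (x : X ⟶ A.carrier) :
    f ≫ A.scal a x = A.scal (f ≫ a) (f ≫ x) := by
  rw [scal, scal, comp_lift_assoc]

lemma comp_brak (f : Y ⟶ X) (x y : X ⟶ A.carrier) :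
    f ≫ A.brak x y = A.brak (f ≫ x) (f ≫ y) := by
  rw [brak, brak, comp_lift_assoc]

end LieOps

variable [BraidedCategory C] [HasFiniteLimits C] [MonoidalClosed C]
variable (k : Type w) [Field k]

/-- The laws of a Lie algebra, on generalized elements: a Euclidean `R`-module with a bilinear,
antisymmetric bracket which satisfies the Jacobi identity, and which is microlinear as an object.
Here an `R`-module `L` is Euclidean if every `f : D ⟶ L` is of the form `f d = f 0 + d • b` for a
unique `b` in `L`. -/
structure LieOps.IsLieAlgebra {R : C} [CommRingObj R] [AlgebraObj k R] (A : LieOps R) : Prop where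
  add_assoc ⦃X : C⦄ (x y z : X ⟶ A.carrier) : A.plus (A.plus x y) z = A.plus x (A.plus y z)
  add_comm ⦃X : C⦄ (x y : X ⟶ A.carrier) : A.plus x y = A.plus y x
  zero_add ⦃X : C⦄ (x : X ⟶ A.carrier) : A.plus (A.nul X) x = x
  neg_add ⦃X : C⦄ (x : X ⟶ A.carrier) : A.plus (A.opp x) x = A.nul X
  one_smul ⦃X : C⦄ (x : X ⟶ A.carrier) : A.scal 1 x = x
  mul_smul ⦃X : C⦄ (a b : X ⟶ R) (x : X ⟶ A.carrier) :
    A.scal (a * b) x = A.scal a (A.scal b x)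
  add_smul ⦃X : C⦄ (a b : X ⟶ R) (x : X ⟶ A.carrier) :
    A.scal (a + b) x = A.plus (A.scal a x) (A.scal b x)
  smul_add ⦃X : C⦄ (a : X ⟶ R) (x y : X ⟶ A.carrier) :
    A.scal a (A.plus x y) = A.plus (A.scal a x) (A.scal a y)
  add_bracket ⦃X : C⦄ (x y z : X ⟶ A.carrier) :
    A.brak (A.plus x y) z = A.plus (A.brak x z) (A.brak y z)
  smul_bracket ⦃X : C⦄ (a : X ⟶ R) (x y : X ⟶ A.carrier) :
    A.brak (A.scal a x) y = A.scal a (A.brak x y)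
  bracket_add ⦃X : C⦄ (x y z : X ⟶ A.carrier) :
    A.brak x (A.plus y z) = A.plus (A.brak x y) (A.brak x z)
  bracket_smul ⦃X : C⦄ (a : X ⟶ R) (x y : X ⟶ A.carrier) :
    A.brak x (A.scal a y) = A.scal a (A.brak x y)
  antisymm ⦃X : C⦄ (x y : X ⟶ A.carrier) : A.brak x y = A.opp (A.brak y x)
  jacobi ⦃X : C⦄ (x y z : X ⟶ A.carrier) :
    A.plus (A.brak x (A.brak y z)) (A.plus (A.brak y (A.brak z x)) (A.brak z (A.brak x y))) =
      A.nul X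
  euclidean ⦃X : C⦄ (f : D R ⊗ X ⟶ A.carrier) : ∃! b : X ⟶ A.carrier,
    f = A.plus (snd _ _ ≫ (λ_ X).inv ≫ zeroD R ▷ X ≫ f) (A.scal (fst _ _ ≫ dnι R 1) (snd _ _ ≫ b))
  microlinear : Microlinear k R A.carrier

/-- An (internal) Lie algebra over `R`. -/
structure LieAlgebraObj (R : C) [CommRingObj R] [AlgebraObj k R] extends LieOps R where
  isLieAlgebra : toLieOps.IsLieAlgebra k

variable {k} in
/-- An isomorphism of Lie algebras: an isomorphism of the underlying objects which respects all the
operations. -/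
structure LieAlgebraObj.Iso {R : C} [CommRingObj R] [AlgebraObj k R]
    (A B : LieAlgebraObj k R) where
  iso : A.carrier ≅ B.carrier
  map_zero : A.zero ≫ iso.hom = B.zero
  map_add : A.add ≫ iso.hom = (iso.hom ⊗ₘ iso.hom) ≫ B.add
  map_neg : A.neg ≫ iso.hom = iso.hom ≫ B.neg
  map_smul : A.smul ≫ iso.hom = R ◁ iso.hom ≫ B.smul
  map_bracket : A.bracket ≫ iso.hom = (iso.hom ⊗ₘ iso.hom) ≫ B.bracket

/-! ### Powers of Lie algebras -/

namespace LieOps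

variable {R : C} (A : LieOps R) (U : C)

/-- The pointwise operations on the exponential `U ⟹ L`. -/
def pow : LieOps R where
  carrier := U ⟹ A.carrier
  zero := MonoidalClosed.curry (A.nul _)
  add := MonoidalClosed.curry
    (A.plus (MonoidalClosed.uncurry (fst _ _)) (MonoidalClosed.uncurry (snd _ _)))
  neg := MonoidalClosed.curry (A.opp (MonoidalClosed.uncurry (𝟙 _)))
  smul := MonoidalClosed.curry (A.scal (snd _ _ ≫ fst _ _) (MonoidalClosed.uncurry (snd _ _)))
  bracket := MonoidalClosed.curry
    (A.brak (MonoidalClosed.uncurry (fst _ _)) (MonoidalClosed.uncurry (snd _ _)))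

variable {A U} {X Y : C}

/-- The transpose of a generalized element of `U ⟹ L`. -/
def tr (x : X ⟶ (A.pow U).carrier) : U ⊗ X ⟶ A.carrier := MonoidalClosed.uncurry x

/-- The generalized element of `U ⟹ L` with a given transpose. -/
def untr (x : U ⊗ X ⟶ A.carrier) : X ⟶ (A.pow U).carrier := MonoidalClosed.curry x

@[simp] lemma tr_untr (x : U ⊗ X ⟶ A.carrier) : tr (untr x) = x := MonoidalClosed.uncurry_curry x

@[simp] lemma untr_tr (x : X ⟶ (A.pow U).carrier) : untr (tr x) = x :=
  MonoidalClosed.curry_uncurry x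

lemma tr_injective {x y : X ⟶ (A.pow U).carrier} (h : tr x = tr y) : x = y :=
  MonoidalClosed.uncurry_injective h

lemma tr_comp (f : Y ⟶ X) (x : X ⟶ (A.pow U).carrier) : tr (f ≫ x) = U ◁ f ≫ tr x :=
  MonoidalClosed.uncurry_natural_left f x

lemma tr_nul : tr ((A.pow U).nul X) = A.nul (U ⊗ X) := by
  rw [nul, tr_comp]
  exact (congrArg (_ ≫ ·) (MonoidalClosed.uncurry_curry _)).trans (A.comp_nul _)

lemma tr_plus (x y : X ⟶ (A.pow U).carrier) :
    tr ((A.pow U).plus x y) = A.plus (tr x) (tr y) := by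
  rw [plus, tr_comp]
  refine (congrArg (_ ≫ ·) (MonoidalClosed.uncurry_curry _)).trans ?_
  refine (A.comp_plus _ _ _).trans (congrArg₂ A.plus ?_ ?_)
  · exact (tr_comp (lift x y) (fst _ _)).symm.trans (congrArg tr (lift_fst _ _))
  · exact (tr_comp (lift x y) (snd _ _)).symm.trans (congrArg tr (lift_snd _ _))

lemma tr_brak (x y : X ⟶ (A.pow U).carrier) :
    tr ((A.pow U).brak x y) = A.brak (tr x) (tr y) := by
  rw [brak, tr_comp]
  refine (congrArg (_ ≫ ·) (MonoidalClosed.uncurry_curry _)).trans ?_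
  refine (A.comp_brak _ _ _).trans (congrArg₂ A.brak ?_ ?_)
  · exact (tr_comp (lift x y) (fst _ _)).symm.trans (congrArg tr (lift_fst _ _))
  · exact (tr_comp (lift x y) (snd _ _)).symm.trans (congrArg tr (lift_snd _ _))

lemma tr_opp (x : X ⟶ (A.pow U).carrier) : tr ((A.pow U).opp x) = A.opp (tr x) := by
  rw [opp, tr_comp]
  refine (congrArg (_ ≫ ·) (MonoidalClosed.uncurry_curry _)).trans ?_
  refine (A.comp_opp _ _).trans (congrArg A.opp ?_)
  exact (tr_comp x (𝟙 _)).symm.trans (congrArg tr (Category.comp_id _))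

lemma tr_scal (a : X ⟶ R) (x : X ⟶ (A.pow U).carrier) :
    tr ((A.pow U).scal a x) = A.scal (snd U X ≫ a) (tr x) := by
  rw [scal, tr_comp]
  refine (congrArg (_ ≫ ·) (MonoidalClosed.uncurry_curry _)).trans ?_
  refine (A.comp_scal _ _ _).trans (congrArg₂ A.scal ?_ ?_)
  · exact (whiskerLeft_snd_assoc U (lift a x) (fst _ _)).trans
      (congrArg (snd U X ≫ ·) (lift_fst a x))
  · exact (tr_comp (lift a x) (snd _ _)).symm.trans (congrArg tr (lift_snd _ _))

end LieOps

variable {k} {R : C} [CommRingObj R] [AlgebraObj k R]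

/-- The Lie algebra `𝔤 ^ U` with the pointwise operations. -/
def LieAlgebraObj.pow (A : LieAlgebraObj k R) (U : C) : LieAlgebraObj k R where
  toLieOps := A.toLieOps.pow U
  isLieAlgebra :=
    have h := A.isLieAlgebra
    { add_assoc X x y z := LieOps.tr_injective (by
        simp only [LieOps.tr_plus, h.add_assoc])
      add_comm X x y := LieOps.tr_injective (by
        simp only [LieOps.tr_plus]; exact h.add_comm _ _)
      zero_add X x := LieOps.tr_injective (by
        simp only [LieOps.tr_plus, LieOps.tr_nul, h.zero_add])
      neg_add X x := LieOps.tr_injective (by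
        simp only [LieOps.tr_plus, LieOps.tr_nul, LieOps.tr_opp, h.neg_add])
      one_smul X x := LieOps.tr_injective (by
        simp only [LieOps.tr_scal, MonObj.comp_one, h.one_smul])
      mul_smul X a b x := LieOps.tr_injective (by
        simp only [LieOps.tr_scal, MonObj.comp_mul, h.mul_smul])
      add_smul X a b x := LieOps.tr_injective (by
        simp only [LieOps.tr_scal, LieOps.tr_plus, AddMonObj.comp_add, h.add_smul])
      smul_add X a x y := LieOps.tr_injective (by
        simp only [LieOps.tr_scal, LieOps.tr_plus, h.smul_add])
      add_bracket X x y z := LieOps.tr_injective (by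
        simp only [LieOps.tr_brak, LieOps.tr_plus, h.add_bracket])
      smul_bracket X a x y := LieOps.tr_injective (by
        simp only [LieOps.tr_brak, LieOps.tr_scal, h.smul_bracket])
      bracket_add X x y z := LieOps.tr_injective (by
        simp only [LieOps.tr_brak, LieOps.tr_plus, h.bracket_add])
      bracket_smul X a x y := LieOps.tr_injective (by
        simp only [LieOps.tr_brak, LieOps.tr_scal, h.bracket_smul])
      antisymm X x y := LieOps.tr_injective (by
        simp only [LieOps.tr_brak, LieOps.tr_opp]; exact h.antisymm _ _)
      jacobi X x y z := LieOps.tr_injective (by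
        simp only [LieOps.tr_brak, LieOps.tr_plus, LieOps.tr_nul, h.jacobi])
      euclidean X f := by
        have key : ∀ b : X ⟶ (A.toLieOps.pow U).carrier,
            f = (A.toLieOps.pow U).plus (snd _ _ ≫ (λ_ X).inv ≫ zeroD R ▷ X ≫ f)
              ((A.toLieOps.pow U).scal (fst _ _ ≫ dnι R 1) (snd _ _ ≫ b)) ↔
            exchange (D R) U X ≫ LieOps.tr f =
              A.plus (snd _ _ ≫ (λ_ (U ⊗ X)).inv ≫ zeroD R ▷ (U ⊗ X) ≫
                exchange (D R) U X ≫ LieOps.tr f)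
              (A.scal (fst _ _ ≫ dnι R 1) (snd _ _ ≫ LieOps.tr b)) := by
          intro b
          have e : ∀ z : D R ⊗ X ⟶ (A.toLieOps.pow U).carrier, f = z ↔
              exchange (D R) U X ≫ LieOps.tr f = exchange (D R) U X ≫ LieOps.tr z := by
            intro z
            refine ⟨fun h => h ▸ rfl, fun h => LieOps.tr_injective ?_⟩
            have := exchange U (D R) X ≫= h
            rwa [exchange_exchange_assoc, exchange_exchange_assoc] at this
          rw [e, LieOps.tr_plus, LieOps.tr_scal, LieOps.comp_plus, LieOps.comp_scal]
          simp only [LieOps.tr_comp]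
          refine Iff.of_eq ?_
          congr 2
          · simp only [← Category.assoc]
            congr 1
            refine CartesianMonoidalCategory.hom_ext _ _ ?_
              (CartesianMonoidalCategory.hom_ext _ _ ?_ ?_) <;> simp [exchange]
          · congr 1
            · simp [exchange]
            · simp only [← Category.assoc]
              congr 1
              refine CartesianMonoidalCategory.hom_ext _ _ ?_ ?_ <;> simp [exchange]
        obtain ⟨b, hb, hu⟩ := h.euclidean (exchange (D R) U X ≫ LieOps.tr f)
        refine ⟨LieOps.untr b, (key _).2 (by rw [LieOps.tr_untr]; exact hb),
          fun b' hb' => ?_⟩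
        rw [← hu _ ((key b').1 hb'), LieOps.untr_tr]
      microlinear := h.microlinear.exp U }

end LieAlgebra

section LieOfGroup

variable {k : Type w} [Field k]
variable {C : Type u} [Category.{v} C] [CartesianMonoidalCategory C] [BraidedCategory C]
  [HasFiniteLimits C] [MonoidalClosed C] (R : C) [CommRingObj R] [AlgebraObj k R]
  (G : C) [GrpObj G]

/-- Evaluation of `t : D ⟶ G` at `0`. -/
def evZero : (D R ⟹ G) ⟶ G := (λ_ _).inv ≫ zeroD R ▷ _ ≫ (ihom.ev (D R)).app G

/-- The object `{t ∈ G ^ D | t 0 = 1}` of tangent vectors at the unit element of `G`. -/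
def lieObj : C := equalizer (evZero R G) (toUnit _ ≫ MonObj.one)

/-- The inclusion of the tangent vectors at the unit element in `G ^ D`. -/
def lieι : lieObj R G ⟶ (D R ⟹ G) := equalizer.ι _ _

variable {R G} {X Y : C}

/-- The map `D × X ⟶ G` given by a tangent vector at stage `X`. -/
def tan (x : X ⟶ lieObj R G) : D R ⊗ X ⟶ G := MonoidalClosed.uncurry (x ≫ lieι R G)

lemma tan_comp (f : Y ⟶ X) (x : X ⟶ lieObj R G) : tan (f ≫ x) = D R ◁ f ≫ tan x := by
  rw [tan, tan, Category.assoc, MonoidalClosed.uncurry_natural_left]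

lemma tan_injective {x y : X ⟶ lieObj R G} (h : tan x = tan y) : x = y :=
  equalizer.hom_ext (MonoidalClosed.uncurry_injective h)

lemma comp_evZero (t : X ⟶ (D R ⟹ G)) :
    t ≫ evZero R G = (λ_ X).inv ≫ zeroD R ▷ X ≫ MonoidalClosed.uncurry t := by
  rw [evZero, MonoidalClosed.uncurry_eq, ← whisker_exchange_assoc, leftUnitor_inv_naturality_assoc]

lemma zeroD_tan (x : X ⟶ lieObj R G) : zeroD R ▷ X ≫ tan x = 1 := by
  have h : lieι R G ≫ evZero R G = lieι R G ≫ (1 : _ ⟶ G) := equalizer.condition _ _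
  have h' := x ≫= h
  rw [← Category.assoc, comp_evZero, MonObj.comp_one, MonObj.comp_one] at h'
  rw [← cancel_epi (λ_ X).inv, MonObj.comp_one]
  exact h'

/-- The tangent vector given by a map `t : D × X ⟶ G` with `t (0, x) = 1`. -/
def lieMk (t : D R ⊗ X ⟶ G) (h : zeroD R ▷ X ≫ t = 1) : X ⟶ lieObj R G :=
  equalizer.lift (MonoidalClosed.curry t) (by
    rw [comp_evZero, MonoidalClosed.uncurry_curry, h, MonObj.comp_one]
    exact (MonObj.comp_one _).symm)

@[simp] lemma tan_lieMk (t : D R ⊗ X ⟶ G) (h : zeroD R ▷ X ≫ t = 1) : tan (lieMk t h) = t := by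
  have : lieMk t h ≫ lieι R G = MonoidalClosed.curry t := equalizer.lift_ι _ _
  rw [tan, this, MonoidalClosed.uncurry_curry]

/-- The value of the tangent vector `x` at `d`, for generalized elements. -/
def val (d : X ⟶ D R) (x : X ⟶ lieObj R G) : X ⟶ G := lift d (𝟙 X) ≫ tan x

lemma val_comp (d : Y ⟶ D R) (f : Y ⟶ X) (x : X ⟶ lieObj R G) :
    val d (f ≫ x) = lift d f ≫ tan x := by
  rw [val, tan_comp, ← Category.assoc]
  simp

lemma comp_val (f : Y ⟶ X) (d : X ⟶ D R) (x : X ⟶ lieObj R G) :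
    f ≫ val d x = val (f ≫ d) (f ≫ x) := by
  rw [val_comp, val, ← Category.assoc]
  simp

lemma tan_eq_val (x : X ⟶ lieObj R G) : tan x = val (fst _ _) (snd (D R) X ≫ x) := by
  rw [val_comp]
  simp

/-- Extensionality of tangent vectors, through their values. -/
lemma val_ext {x y : X ⟶ lieObj R G}
    (h : ∀ (Y : C) (f : Y ⟶ X) (d : Y ⟶ D R), val d (f ≫ x) = val d (f ≫ y)) : x = y :=
  tan_injective (by rw [tan_eq_val, tan_eq_val, h])

lemma val_zeroD (x : X ⟶ lieObj R G) : val (toUnit X ≫ zeroD R) x = 1 := by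
  have : lift (toUnit X ≫ zeroD R) (𝟙 X) = (λ_ X).inv ≫ zeroD R ▷ X := by
    refine CartesianMonoidalCategory.hom_ext _ _ ?_ ?_ <;> simp
  rw [val, this, Category.assoc, zeroD_tan, MonObj.comp_one]

lemma val_lieMk (t : D R ⊗ X ⟶ G) (h : zeroD R ▷ X ≫ t = 1) (f : Y ⟶ X) (d : Y ⟶ D R) :
    val d (f ≫ lieMk t h) = lift d f ≫ t := by
  rw [val_comp, tan_lieMk]

/-! ### Consequences of microlinearity -/

variable (R) in
/-- The addition `(d₁, d₂) ↦ d₁ + d₂` from `D(2)` to `D`. -/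
def addD2 : D2 R ⟶ D R :=
  dLift ((d2ι R ≫ fst _ _) ≫ dnι R 1 + (d2ι R ≫ snd _ _) ≫ dnι R 1) (by
    have h := d2_mul R
    have h' := h
    rw [mul_comm] at h'
    rw [add_mul, mul_add, mul_add, comp_dι_mul_self, comp_dι_mul_self, h, h']
    simp)

lemma d2_hom_ext (hG : Microlinear k R G) {l l' : D2 R ⊗ X ⟶ G}
    (h₁ : d2Inl R ▷ X ≫ l = d2Inl R ▷ X ≫ l') (h₂ : d2Inr R ▷ X ≫ l = d2Inr R ▷ X ≫ l') :
    l = l' := by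
  have e : zeroD R ≫ d2Inl R = zeroD R ≫ d2Inr R := by
    refine (cancel_mono (d2ι R)).1 ?_
    simp only [d2Inl, d2Inr, Category.assoc, d2Lift_ι]
    refine CartesianMonoidalCategory.hom_ext _ _ ?_ ?_
    · simp
    · simp
  refine (hG.d2 (d2Inl R ▷ X ≫ l') (d2Inr R ▷ X ≫ l') ?_).unique ⟨h₁, h₂⟩ ⟨rfl, rfl⟩
  rw [← comp_whiskerRight_assoc, e, comp_whiskerRight_assoc]

/-- Generalized elements of `D(2) × X` at which a map into `G` is tested. -/
lemma d2_hom_ext' (hG : Microlinear k R G) {l l' : D2 R ⊗ X ⟶ G}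
    (h₁ : ∀ (Y : C) (f : Y ⟶ X) (d : Y ⟶ D R), lift (d ≫ d2Inl R) f ≫ l = lift (d ≫ d2Inl R) f ≫ l')
    (h₂ : ∀ (Y : C) (f : Y ⟶ X) (d : Y ⟶ D R), lift (d ≫ d2Inr R) f ≫ l = lift (d ≫ d2Inr R) f ≫ l') :
    l = l' := by
  have e : ∀ i : D R ⟶ D2 R, i ▷ X = lift (fst _ _ ≫ i) (snd _ _) := fun i => by
    refine CartesianMonoidalCategory.hom_ext _ _ ?_ ?_ <;> simp
  refine d2_hom_ext hG ?_ ?_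
  · rw [e, h₁]
  · rw [e, h₂]

section D2Elements

variable (d e : X ⟶ D R) (h : (d ≫ dnι R 1) * (e ≫ dnι R 1) = 0)

lemma d2Inl_fst : d2Inl R ≫ d2ι R ≫ fst _ _ = 𝟙 _ := by simp [d2Inl]
lemma d2Inl_snd : d2Inl R ≫ d2ι R ≫ snd _ _ = toUnit _ ≫ zeroD R := by simp [d2Inl]
lemma d2Inr_fst : d2Inr R ≫ d2ι R ≫ fst _ _ = toUnit _ ≫ zeroD R := by simp [d2Inr]
lemma d2Inr_snd : d2Inr R ≫ d2ι R ≫ snd _ _ = 𝟙 _ := by simp [d2Inr]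

lemma d2Lift_fst : d2Lift d e h ≫ d2ι R ≫ fst _ _ = d := by simp
lemma d2Lift_snd : d2Lift d e h ≫ d2ι R ≫ snd _ _ = e := by simp

end D2Elements

/-- Tangent vectors commute on `D(2)`. -/
lemma val_commute (hG : Microlinear k R G) (x y : X ⟶ lieObj R G) (d e : X ⟶ D R)
    (h : (d ≫ dnι R 1) * (e ≫ dnι R 1) = 0) : val d x * val e y = val e y * val d x := by
  let a : D2 R ⊗ X ⟶ D R := fst _ _ ≫ d2ι R ≫ fst _ _
  let b : D2 R ⊗ X ⟶ D R := fst _ _ ≫ d2ι R ≫ snd _ _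
  have key : val a (snd _ _ ≫ x) * val b (snd _ _ ≫ y) =
      val b (snd _ _ ≫ y) * val a (snd _ _ ≫ x) := by
    refine d2_hom_ext' hG (fun Y f d' => ?_) (fun Y f d' => ?_)
    all_goals
      simp only [MonObj.comp_mul, comp_val, a, b, lift_fst_assoc, lift_snd_assoc, Category.assoc,
        d2Inl_fst, d2Inl_snd, d2Inr_fst, d2Inr_snd, comp_toUnit_assoc, val_zeroD, mul_one, one_mul]
  have := lift (d2Lift d e h) (𝟙 X) ≫= key
  simpa only [MonObj.comp_mul, comp_val, a, b, lift_fst_assoc, lift_snd_assoc, d2Lift_fst,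
    d2Lift_snd, Category.id_comp] using this

/-- The value of a tangent vector at `d + e`, for `(d, e)` in `D(2)`. -/
lemma val_add (hG : Microlinear k R G) (x : X ⟶ lieObj R G) (d e s : X ⟶ D R)
    (h : (d ≫ dnι R 1) * (e ≫ dnι R 1) = 0) (hs : s ≫ dnι R 1 = d ≫ dnι R 1 + e ≫ dnι R 1) :
    val s x = val d x * val e x := by
  let a : D2 R ⊗ X ⟶ D R := fst _ _ ≫ d2ι R ≫ fst _ _
  let b : D2 R ⊗ X ⟶ D R := fst _ _ ≫ d2ι R ≫ snd _ _
  have hl : d2Inl R ≫ addD2 R = 𝟙 _ := d_ext (by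
    rw [addD2, Category.assoc, dLift_ι, AddMonObj.comp_add]
    simp only [← Category.assoc, d2Inl, d2Lift_ι, lift_fst, lift_snd]
    rw [zeroD_ι, add_zero])
  have hr : d2Inr R ≫ addD2 R = 𝟙 _ := d_ext (by
    rw [addD2, Category.assoc, dLift_ι, AddMonObj.comp_add]
    simp only [← Category.assoc, d2Inr, d2Lift_ι, lift_fst, lift_snd]
    rw [zeroD_ι, zero_add])
  have key : val (fst _ _ ≫ addD2 R) (snd _ _ ≫ x) = val a (snd _ _ ≫ x) * val b (snd _ _ ≫ x) := by
    refine d2_hom_ext' hG (fun Y f d' => ?_) (fun Y f d' => ?_)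
    all_goals
      simp only [MonObj.comp_mul, comp_val, a, b, lift_fst_assoc, lift_snd_assoc, Category.assoc,
        d2Inl_fst, d2Inl_snd, d2Inr_fst, d2Inr_snd, comp_toUnit_assoc, val_zeroD, mul_one, one_mul,
        hl, hr]
  have hs' : d2Lift d e h ≫ addD2 R = s := d_ext (by
    rw [addD2, Category.assoc, dLift_ι, AddMonObj.comp_add, hs]
    simp only [← Category.assoc, d2Lift_ι, lift_fst, lift_snd])
  have := lift (d2Lift d e h) (𝟙 X) ≫= key
  simpa only [MonObj.comp_mul, comp_val, a, b, lift_fst_assoc, lift_snd_assoc, d2Lift_fst,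
    d2Lift_snd, Category.id_comp, hs'] using this

lemma negD_ι (d : X ⟶ D R) : (d ≫ negD R) ≫ dnι R 1 = -(d ≫ dnι R 1) := by
  rw [Category.assoc, negD, dLift_ι]
  exact map_neg (precomp R d) _

lemma val_negD (hG : Microlinear k R G) (x : X ⟶ lieObj R G) (d : X ⟶ D R) :
    val (d ≫ negD R) x = (val d x)⁻¹ := by
  refine eq_inv_of_mul_eq_one_right ?_
  rw [← val_add hG x d (d ≫ negD R) (toUnit _ ≫ zeroD R), val_zeroD]
  · rw [negD_ι, mul_neg, comp_dι_mul_self, neg_zero]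
  · rw [negD_ι, zeroD_ι, add_neg_cancel]

/-! ### The operations -/

variable (G) in
/-- The two tangent vectors `x`, `y` extend uniquely to a map on `D(2)`. -/
lemma exists_sum (hG : Microlinear k R G) (x y : X ⟶ lieObj R G) :
    ∃! l : D2 R ⊗ X ⟶ G, d2Inl R ▷ X ≫ l = tan x ∧ d2Inr R ▷ X ≫ l = tan y :=
  hG.d2 _ _ (by rw [zeroD_tan, zeroD_tan])

/-- The sum of `x` and `y` is `d ↦ l (d, d)`, where `l : D(2) ⟶ G` is the unique map with
`l (d, 0) = x d` and `l (0, d) = y d`. -/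
def lieAdd (hG : Microlinear k R G) : lieObj R G ⊗ lieObj R G ⟶ lieObj R G :=
  lieMk (d2Diag R ▷ _ ≫ (exists_sum G hG (fst _ _) (snd _ _)).choose) (by
    have h := (exists_sum G hG (fst (lieObj R G) (lieObj R G)) (snd _ _)).choose_spec.1.1
    have e : zeroD R ≫ d2Diag R = zeroD R ≫ d2Inl R := by
      refine (cancel_mono (d2ι R)).1 ?_
      simp only [d2Inl, d2Diag, Category.assoc, d2Lift_ι]
      refine CartesianMonoidalCategory.hom_ext _ _ ?_ ?_ <;> simp
    rw [← comp_whiskerRight_assoc, e, comp_whiskerRight_assoc, h, zeroD_tan])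

lemma val_lieAdd (hG : Microlinear k R G) (x y : X ⟶ lieObj R G) (d : X ⟶ D R) :
    val d (lift x y ≫ lieAdd hG) = val d x * val d y := by
  have hu := (exists_sum G hG (fst (lieObj R G) (lieObj R G)) (snd _ _)).choose_spec.1
  set l := (exists_sum G hG (fst (lieObj R G) (lieObj R G)) (snd _ _)).choose with hl
  let a : D2 R ⊗ (lieObj R G ⊗ lieObj R G) ⟶ D R := fst _ _ ≫ d2ι R ≫ fst _ _
  let b : D2 R ⊗ (lieObj R G ⊗ lieObj R G) ⟶ D R := fst _ _ ≫ d2ι R ≫ snd _ _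
  have key : l = val a (snd _ _ ≫ fst _ _) * val b (snd _ _ ≫ snd _ _) := by
    have e : ∀ (Y : C) (i : D R ⟶ D2 R) (f : Y ⟶ lieObj R G ⊗ lieObj R G) (d' : Y ⟶ D R),
        lift (d' ≫ i) f ≫ l = lift d' f ≫ i ▷ _ ≫ l := by
      intro Y i f d'
      rw [lift_whiskerRight_assoc]
    refine d2_hom_ext' hG (fun Y f d' => ?_) (fun Y f d' => ?_)
    · rw [e, hu.1, ← val_comp]
      simp only [MonObj.comp_mul, comp_val, a, b, lift_fst_assoc, lift_snd_assoc, Category.assoc,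
        d2Inl_fst, d2Inl_snd, comp_toUnit_assoc, val_zeroD, mul_one, Category.comp_id]
    · rw [e, hu.2, ← val_comp]
      simp only [MonObj.comp_mul, comp_val, a, b, lift_fst_assoc, lift_snd_assoc, Category.assoc,
        d2Inr_fst, d2Inr_snd, comp_toUnit_assoc, val_zeroD, one_mul, Category.comp_id]
  have hd₁ : d2Diag R ≫ d2ι R ≫ fst _ _ = 𝟙 _ := by simp [d2Diag]
  have hd₂ : d2Diag R ≫ d2ι R ≫ snd _ _ = 𝟙 _ := by simp [d2Diag]
  rw [lieAdd, val_lieMk, ← hl, key]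
  simp only [MonObj.comp_mul, comp_val, a, b, lift_whiskerRight_assoc, lift_fst_assoc,
    lift_snd_assoc, Category.assoc, hd₁, hd₂, Category.comp_id, lift_fst, lift_snd]

lemma lift_mulD_ι (d e : X ⟶ D R) :
    (lift d e ≫ mulD R) ≫ dnι R 1 = (d ≫ dnι R 1) * (e ≫ dnι R 1) := by
  rw [Category.assoc, mulD, dLift_ι, MonObj.comp_mul, lift_fst_assoc, lift_snd_assoc]

lemma lift_smulD_ι (d : X ⟶ D R) (a : X ⟶ R) :
    (lift d a ≫ smulD R) ≫ dnι R 1 = a * (d ≫ dnι R 1) := by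
  rw [Category.assoc, smulD, dLift_ι, MonObj.comp_mul, lift_snd, lift_fst_assoc]

/-- The commutator `(d₁, d₂) ↦ x d₁ * y d₂ * x (-d₁) * y (-d₂)`. -/
def commMap (x y : X ⟶ lieObj R G) : (D R ⊗ D R) ⊗ X ⟶ G :=
  val (fst _ _ ≫ fst _ _) (snd _ _ ≫ x) * val (fst _ _ ≫ snd _ _) (snd _ _ ≫ y) *
    val (fst _ _ ≫ fst _ _ ≫ negD R) (snd _ _ ≫ x) *
    val (fst _ _ ≫ snd _ _ ≫ negD R) (snd _ _ ≫ y)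

lemma lift_commMap (hG : Microlinear k R G) (x y : X ⟶ lieObj R G) (d : Y ⟶ D R ⊗ D R)
    (f : Y ⟶ X) : lift d f ≫ commMap x y =
      ⁅val (d ≫ fst _ _) (f ≫ x), val (d ≫ snd _ _) (f ≫ y)⁆ := by
  simp only [commMap, MonObj.comp_mul, comp_val, lift_fst_assoc, lift_snd_assoc]
  rw [← Category.assoc d, ← Category.assoc d, val_negD hG, val_negD hG]
  rfl

/-- The commutator factors uniquely through the multiplication `D × D ⟶ D`. -/
lemma exists_bracket (hG : Microlinear k R G) (x y : X ⟶ lieObj R G) :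
    ∃! s : D R ⊗ X ⟶ G, mulD R ▷ X ≫ s = commMap x y ∧ zeroD R ▷ X ≫ s = 1 := by
  refine hG.dd _ _ ?_
  have e : d2ι R ▷ X = lift (fst _ _ ≫ d2ι R) (snd _ _) := by
    refine CartesianMonoidalCategory.hom_ext _ _ ?_ ?_ <;> simp
  rw [MonObj.comp_one, e, lift_commMap hG, commutatorElement_eq_one_iff_mul_comm]
  refine val_commute hG _ _ _ _ ?_
  have := congrArg (precomp R (fst (D2 R) X)) (d2_mul R)
  rw [map_mul, map_zero] at this
  simpa [precomp] using this

/-- The bracket `[x, y]` is the unique tangent vector with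
`[x, y] (d₁ d₂) = x d₁ * y d₂ * x (-d₁) * y (-d₂)`. -/
def lieBracket (hG : Microlinear k R G) : lieObj R G ⊗ lieObj R G ⟶ lieObj R G :=
  lieMk (exists_bracket hG (fst _ _) (snd _ _)).choose
    (exists_bracket hG (fst _ _) (snd _ _)).choose_spec.1.2

lemma val_lieBracket (hG : Microlinear k R G) (x y : X ⟶ lieObj R G) (d e s : X ⟶ D R)
    (hs : s ≫ dnι R 1 = (d ≫ dnι R 1) * (e ≫ dnι R 1)) :
    val s (lift x y ≫ lieBracket hG) = ⁅val d x, val e y⁆ := by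
  have hs' : s = lift d e ≫ mulD R := d_ext (by rw [hs, lift_mulD_ι])
  have e' : lift (lift d e ≫ mulD R) (lift x y) = lift (lift d e) (lift x y) ≫ mulD R ▷ _ := by
    rw [lift_whiskerRight]
  rw [lieBracket, val_lieMk, hs', e', Category.assoc,
    (exists_bracket hG (fst (lieObj R G) (lieObj R G)) (snd _ _)).choose_spec.1.1, lift_commMap hG]
  simp

/-- A tangent vector is determined by its values at the products `d₁ d₂`. -/
lemma val_ext₂ (hG : Microlinear k R G) {x y : X ⟶ lieObj R G}
    (h : ∀ (Y : C) (f : Y ⟶ X) (d e : Y ⟶ D R),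
      val (lift d e ≫ mulD R) (f ≫ x) = val (lift d e ≫ mulD R) (f ≫ y)) : x = y := by
  refine tan_injective ((hG.dd (mulD R ▷ X ≫ tan y) 1 ?_).unique ⟨?_, zeroD_tan x⟩
    ⟨rfl, zeroD_tan y⟩)
  · have e : d2ι R ≫ mulD R = toUnit _ ≫ zeroD R := d_ext (by
      have h' : d2ι R = lift (d2ι R ≫ fst _ _) (d2ι R ≫ snd _ _) := by
        refine CartesianMonoidalCategory.hom_ext _ _ ?_ ?_ <;> simp
      rw [zeroD_ι, ← d2_mul R, h', lift_mulD_ι, ← h'])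
    rw [← comp_whiskerRight_assoc, e, comp_whiskerRight_assoc, zeroD_tan]
  · have := h ((D R ⊗ D R) ⊗ X) (snd _ _) (fst _ _ ≫ fst _ _) (fst _ _ ≫ snd _ _)
    rw [val_comp, val_comp] at this
    convert this using 2 <;>
    · refine CartesianMonoidalCategory.hom_ext _ _ ?_ ?_
      · simp only [whiskerRight_fst, lift_fst]
        congr 1
        refine CartesianMonoidalCategory.hom_ext _ _ ?_ ?_ <;> simp
      · simp

/-- The zero tangent vector `d ↦ 1`. -/
def lieZero : 𝟙_ C ⟶ lieObj R G := lieMk 1 (MonObj.comp_one _)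

lemma val_lieZero (f : X ⟶ 𝟙_ C) (d : X ⟶ D R) : val d (f ≫ lieZero (R := R) (G := G)) = 1 := by
  rw [lieZero, val_lieMk, MonObj.comp_one]

variable (R G) in
/-- The negative `d ↦ x (-d)` of the tangent vector `x`. -/
def lieNeg : lieObj R G ⟶ lieObj R G := lieMk (negD R ▷ _ ≫ tan (𝟙 _)) (by
  have : zeroD R ≫ negD R = zeroD R := d_ext (by
    have h : zeroD R ≫ dnι R 1 = 0 := dLift_ι _ _
    rw [negD_ι, h, neg_zero])
  rw [← comp_whiskerRight_assoc, this, zeroD_tan])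

lemma val_lieNeg (x : X ⟶ lieObj R G) (d : X ⟶ D R) :
    val d (x ≫ lieNeg R G) = val (d ≫ negD R) x := by
  rw [lieNeg, val_lieMk, lift_whiskerRight_assoc, ← val_comp, Category.comp_id]

variable (R G) in
/-- The scalar multiple `d ↦ x (a d)` of the tangent vector `x` by `a` in `R`. -/
def lieSMul : R ⊗ lieObj R G ⟶ lieObj R G :=
  lieMk (val (lift (fst _ _) (snd _ _ ≫ fst _ _) ≫ smulD R) (snd _ _ ≫ snd _ _)) (by
    have : zeroD R ▷ (R ⊗ lieObj R G) ≫ lift (fst _ _) (snd _ _ ≫ fst _ _) ≫ smulD R =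
        toUnit _ ≫ zeroD R := d_ext (by
      have h : zeroD R ▷ (R ⊗ lieObj R G) ≫ fst _ _ = toUnit _ ≫ zeroD R := by
        rw [whiskerRight_fst]
        congr 1
        exact toUnit_unique _ _
      rw [comp_lift_assoc, lift_smulD_ι, h, zeroD_ι, mul_zero])
    rw [comp_val, this, val_zeroD])

lemma val_lieSMul (a : X ⟶ R) (x : X ⟶ lieObj R G) (d : X ⟶ D R) :
    val d (lift a x ≫ lieSMul R G) = val (lift d a ≫ smulD R) x := by
  rw [lieSMul, val_lieMk, comp_val, comp_lift_assoc]
  simp only [lift_fst, lift_snd, lift_snd_assoc]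

variable (R G) in
/-- The Lie algebra operations on the tangent vectors at the unit element of `G`. -/
def lieOps (hG : Microlinear k R G) : LieOps R where
  carrier := lieObj R G
  zero := lieZero
  add := lieAdd hG
  neg := lieNeg R G
  smul := lieSMul R G
  bracket := lieBracket hG

end LieOfGroup

section Laws

lemma commute_commutator {H : Type*} [Group H] {x y z : H} (h : Commute z x) (h' : Commute z y) :
    Commute z ⁅x, y⁆ :=
  ((h.mul_right h').mul_right h.inv_right).mul_right h'.inv_right

/-- A form of the Hall-Witt identity. -/
lemma hallWitt {H : Type*} [Group H] (a b c : H)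
    (pq : Commute ⁅b, c⁆ ⁅c, a⁆) (pr : Commute ⁅b, c⁆ ⁅a, b⁆) (qr : Commute ⁅c, a⁆ ⁅a, b⁆)
    (hv : ∀ x ∈ ({a, b, c} : Set H), Commute ⁅b, ⁅c, a⁆⁆ x)
    (hw : ∀ x ∈ ({a, b, c} : Set H), Commute ⁅c, ⁅a, b⁆⁆ x) :
    ⁅a, ⁅b, c⁆⁆ * (⁅b, ⁅c, a⁆⁆ * ⁅c, ⁅a, b⁆⁆) = 1 := by
  have key : ⁅a, ⁅b, c⁆⁆ * ⁅b, c⁆ * ⁅c, a⁆⁻¹ * ⁅c, ⁅a, b⁆⁆ * ⁅a, b⁆ =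
      ⁅a, b⁆ * ⁅c, a⁆⁻¹ * ⁅b, ⁅c, a⁆⁆⁻¹ * ⁅b, c⁆ := by
    simp only [commutatorElement_def]; group
  simp only [Set.mem_insert_iff, Set.mem_singleton_iff, forall_eq_or_imp, forall_eq] at hv hw
  have wp := commute_commutator hw.2.1 hw.2.2
  have wq := commute_commutator hw.2.2 hw.1
  have vp := commute_commutator hv.2.1 hv.2.2
  have vq := commute_commutator hv.2.2 hv.1
  have vr := commute_commutator hv.1 hv.2.1
  have wv : Commute ⁅c, ⁅a, b⁆⁆ ⁅b, ⁅c, a⁆⁆ := commute_commutator hw.2.1 wq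
  generalize ⁅a, ⁅b, c⁆⁆ = u at *
  generalize ⁅b, ⁅c, a⁆⁆ = v at *
  generalize ⁅c, ⁅a, b⁆⁆ = w at *
  generalize ⁅b, c⁆ = p at *
  generalize ⁅c, a⁆ = q at *
  generalize ⁅a, b⁆ = r at *
  have l : u * p * q⁻¹ * w * r = u * w * (p * q⁻¹ * r) := by
    have h : Commute (p * q⁻¹) w := (wp.mul_right wq.inv_right).symm
    rw [mul_assoc u p, mul_assoc u (p * q⁻¹), h.eq]
    group
  have m : r * q⁻¹ * v⁻¹ * p = v⁻¹ * (p * q⁻¹ * r) := by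
    have h : Commute (r * q⁻¹) v⁻¹ := (vr.mul_right vq.inv_right).symm.inv_right
    have h' : Commute (r * q⁻¹) p := (pr.mul_right pq.inv_right).symm
    rw [h.eq, mul_assoc, h'.eq, mul_assoc p, qr.inv_left.eq]
  rw [l, m, mul_left_inj] at key
  rw [← wv.eq, ← mul_assoc, key, inv_mul_cancel]

lemma commutator_mul_left {H : Type*} [Group H] (a b c : H) (h : Commute a ⁅b, c⁆)
    (h' : Commute ⁅a, c⁆ ⁅b, c⁆) : ⁅a * b, c⁆ = ⁅a, c⁆ * ⁅b, c⁆ := by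
  rw [h'.eq]
  have : ⁅a * b, c⁆ = a * ⁅b, c⁆ * (c * a⁻¹ * c⁻¹) := by
    simp only [commutatorElement_def]; group
  rw [this, h.eq, commutatorElement_def a c]
  group

lemma commutator_mul_right {H : Type*} [Group H] (a b c : H) (h : Commute b ⁅a, c⁆) :
    ⁅a, b * c⁆ = ⁅a, b⁆ * ⁅a, c⁆ := by
  have : ⁅a, b * c⁆ = a * b * a⁻¹ * (⁅a, c⁆ * b⁻¹) := by
    simp only [commutatorElement_def]; group
  rw [this, ← h.inv_left.eq, commutatorElement_def a b]
  group

variable {k : Type w} [Field k]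
variable {C : Type u} [Category.{v} C] [CartesianMonoidalCategory C] [BraidedCategory C]
  [HasFiniteLimits C] [MonoidalClosed C] {R : C} [CommRingObj R] [AlgebraObj k R]
  {G : C} [GrpObj G] {X Y : C}

section Values

variable (hG : Microlinear k R G)

/-- The value at `d` of a generalized element of the Lie algebra. -/
def ev (d : X ⟶ D R) (x : X ⟶ (lieOps R G hG).carrier) : X ⟶ G := val (G := G) d x

lemma ev_nul (d : X ⟶ D R) : ev hG d ((lieOps R G hG).nul X) = 1 := val_lieZero _ d

lemma ev_zeroD (x : X ⟶ (lieOps R G hG).carrier) : ev hG (toUnit X ≫ zeroD R) x = 1 := val_zeroD x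

lemma ev_plus (x y : X ⟶ (lieOps R G hG).carrier) (d : X ⟶ D R) :
    ev hG d ((lieOps R G hG).plus x y) = ev hG d x * ev hG d y := val_lieAdd hG x y d

lemma ev_opp (x : X ⟶ (lieOps R G hG).carrier) (d : X ⟶ D R) :
    ev hG d ((lieOps R G hG).opp x) = (ev hG d x)⁻¹ :=
  (val_lieNeg x d).trans (val_negD hG x d)

lemma ev_scal (a : X ⟶ R) (x : X ⟶ (lieOps R G hG).carrier) (d : X ⟶ D R) :
    ev hG d ((lieOps R G hG).scal a x) = ev hG (lift d a ≫ smulD R) x := val_lieSMul a x d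

lemma ev_brak (x y : X ⟶ (lieOps R G hG).carrier) (d e : X ⟶ D R) :
    ev hG (lift d e ≫ mulD R) ((lieOps R G hG).brak x y) = ⁅ev hG d x, ev hG e y⁆ :=
  val_lieBracket hG x y d e _ (lift_mulD_ι d e)

lemma ev_commute (x y : X ⟶ (lieOps R G hG).carrier) (d e : X ⟶ D R)
    (h : (d ≫ dnι R 1) * (e ≫ dnι R 1) = 0) : Commute (ev hG d x) (ev hG e y) :=
  val_commute hG x y d e h

lemma ev_add (x : X ⟶ (lieOps R G hG).carrier) (d e s : X ⟶ D R)
    (h : (d ≫ dnι R 1) * (e ≫ dnι R 1) = 0) (hs : s ≫ dnι R 1 = d ≫ dnι R 1 + e ≫ dnι R 1) :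
    ev hG s x = ev hG d x * ev hG e x := val_add hG x d e s h hs

lemma ev_congr {d e : X ⟶ D R} (x : X ⟶ (lieOps R G hG).carrier)
    (h : d ≫ dnι R 1 = e ≫ dnι R 1) : ev hG d x = ev hG e x := by rw [d_ext h]

lemma comp_ev (f : Y ⟶ X) (d : X ⟶ D R) (x : X ⟶ (lieOps R G hG).carrier) :
    f ≫ ev hG d x = ev hG (f ≫ d) (f ≫ x) := comp_val f d x

lemma lie_ext {x y : X ⟶ (lieOps R G hG).carrier}
    (h : ∀ (Y : C) (f : Y ⟶ X) (d : Y ⟶ D R), ev hG d (f ≫ x) = ev hG d (f ≫ y)) : x = y :=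
  val_ext h

lemma lie_ext₂ {x y : X ⟶ (lieOps R G hG).carrier}
    (h : ∀ (Y : C) (f : Y ⟶ X) (d e : Y ⟶ D R),
      ev hG (lift d e ≫ mulD R) (f ≫ x) = ev hG (lift d e ≫ mulD R) (f ≫ y)) : x = y :=
  val_ext₂ hG h

lemma lie_ext₃ {x y : X ⟶ (lieOps R G hG).carrier}
    (h : ∀ (Y : C) (f : Y ⟶ X) (d e c : Y ⟶ D R),
      ev hG (lift d (lift e c ≫ mulD R) ≫ mulD R) (f ≫ x) =
        ev hG (lift d (lift e c ≫ mulD R) ≫ mulD R) (f ≫ y)) : x = y := by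
  refine lie_ext₂ hG fun Y f d s => ?_
  have e : ∀ z : X ⟶ (lieOps R G hG).carrier, ev hG (lift d s ≫ mulD R) (f ≫ z) =
      ev hG s ((lieOps R G hG).scal (d ≫ dnι R 1) (f ≫ z)) := fun z => by
    rw [ev_scal]
    exact ev_congr hG _ (by rw [lift_mulD_ι, lift_smulD_ι])
  rw [e, e]
  refine congrArg (ev hG s) (lie_ext₂ hG fun Z g e c => ?_)
  have e' : ∀ z : X ⟶ (lieOps R G hG).carrier,
      ev hG (lift e c ≫ mulD R) (g ≫ (lieOps R G hG).scal (d ≫ dnι R 1) (f ≫ z)) =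
        ev hG (lift (g ≫ d) (lift e c ≫ mulD R) ≫ mulD R) ((g ≫ f) ≫ z) := fun z => by
    rw [LieOps.comp_scal, ev_scal, Category.assoc]
    exact ev_congr hG _ (by rw [lift_smulD_ι, lift_mulD_ι _ (lift e c ≫ mulD R), Category.assoc g])
  rw [e', e', h]

end Values

/-- The tangent vectors at the unit element of a microlinear group satisfy the laws of a Lie
algebra. -/
lemma lieOps_isLieAlgebra (hG : Microlinear k R G) : (lieOps R G hG).IsLieAlgebra k where
  add_assoc X x y z := lie_ext hG fun Y f d => by
    simp only [LieOps.comp_plus, ev_plus, mul_assoc]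
  add_comm X x y := lie_ext hG fun Y f d => by
    simp only [LieOps.comp_plus, ev_plus]
    exact ev_commute hG _ _ _ _ (comp_dι_mul_self d)
  zero_add X x := lie_ext hG fun Y f d => by
    simp only [LieOps.comp_plus, LieOps.comp_nul, ev_plus, ev_nul, one_mul]
  neg_add X x := lie_ext hG fun Y f d => by
    simp only [LieOps.comp_plus, LieOps.comp_nul, LieOps.comp_opp, ev_plus, ev_nul, ev_opp,
      inv_mul_cancel]
  one_smul X x := lie_ext hG fun Y f d => by
    simp only [LieOps.comp_scal, ev_scal, MonObj.comp_one]
    exact ev_congr hG _ (by rw [lift_smulD_ι, one_mul])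
  mul_smul X a b x := lie_ext hG fun Y f d => by
    simp only [LieOps.comp_scal, ev_scal, MonObj.comp_mul]
    exact ev_congr hG _ (by
      rw [lift_smulD_ι, lift_smulD_ι, lift_smulD_ι, mul_left_comm, mul_assoc])
  add_smul X a b x := lie_ext hG fun Y f d => by
    simp only [LieOps.comp_scal, LieOps.comp_plus, ev_plus, ev_scal, AddMonObj.comp_add]
    refine ev_add hG _ _ _ _ ?_ ?_
    · rw [lift_smulD_ι, lift_smulD_ι, mul_mul_mul_comm, comp_dι_mul_self, mul_zero]
    · rw [lift_smulD_ι, lift_smulD_ι, lift_smulD_ι, add_mul]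
  smul_add X a x y := lie_ext hG fun Y f d => by
    simp only [LieOps.comp_scal, LieOps.comp_plus, ev_plus, ev_scal]
  add_bracket X x y z := lie_ext₂ hG fun Y f d e => by
    simp only [LieOps.comp_brak, LieOps.comp_plus, ev_plus, ev_brak]
    have h := ev_commute hG (f ≫ x) ((lieOps R G hG).brak (f ≫ y) (f ≫ z)) d (lift d e ≫ mulD R)
      (by rw [lift_mulD_ι, ← mul_assoc, comp_dι_mul_self, zero_mul])
    have h' := ev_commute hG ((lieOps R G hG).brak (f ≫ x) (f ≫ z))
      ((lieOps R G hG).brak (f ≫ y) (f ≫ z)) (lift d e ≫ mulD R) (lift d e ≫ mulD R)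
      (comp_dι_mul_self _)
    rw [ev_brak] at h h'
    rw [ev_brak] at h'
    exact commutator_mul_left _ _ _ h h'
  smul_bracket X a x y := lie_ext₂ hG fun Y f d e => by
    simp only [LieOps.comp_brak, LieOps.comp_scal, ev_scal, ev_brak]
    rw [← ev_brak]
    refine ev_congr hG _ ?_
    simp only [lift_smulD_ι, lift_mulD_ι, mul_assoc]
  bracket_add X x y z := lie_ext₂ hG fun Y f d e => by
    simp only [LieOps.comp_brak, LieOps.comp_plus, ev_plus, ev_brak]
    have h := ev_commute hG (f ≫ y) ((lieOps R G hG).brak (f ≫ x) (f ≫ z)) e (lift d e ≫ mulD R)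
      (by rw [lift_mulD_ι, mul_left_comm, comp_dι_mul_self, mul_zero])
    rw [ev_brak] at h
    exact commutator_mul_right _ _ _ h
  bracket_smul X a x y := lie_ext₂ hG fun Y f d e => by
    simp only [LieOps.comp_brak, LieOps.comp_scal, ev_scal, ev_brak]
    rw [← ev_brak]
    refine ev_congr hG _ ?_
    simp only [lift_smulD_ι, lift_mulD_ι, mul_left_comm]
  antisymm X x y := lie_ext₂ hG fun Y f d e => by
    simp only [LieOps.comp_brak, LieOps.comp_opp, ev_opp]
    have : ev hG (lift d e ≫ mulD R) ((lieOps R G hG).brak (f ≫ y) (f ≫ x)) =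
        ev hG (lift e d ≫ mulD R) ((lieOps R G hG).brak (f ≫ y) (f ≫ x)) :=
      ev_congr hG _ (by rw [lift_mulD_ι, lift_mulD_ι, mul_comm])
    rw [this, ev_brak, ev_brak, commutatorElement_inv]
  jacobi X x y z := lie_ext₃ hG fun Y f d e c => by
    let L := lieOps R G hG
    have cyc₁ : ev hG (lift d (lift e c ≫ mulD R) ≫ mulD R)
        (L.brak (f ≫ y) (L.brak (f ≫ z) (f ≫ x))) =
          ⁅ev hG e (f ≫ y), ⁅ev hG c (f ≫ z), ev hG d (f ≫ x)⁆⁆ := by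
      rw [← ev_brak, ← ev_brak]
      exact ev_congr hG _ (by simp only [lift_mulD_ι]; ring)
    have cyc₂ : ev hG (lift d (lift e c ≫ mulD R) ≫ mulD R)
        (L.brak (f ≫ z) (L.brak (f ≫ x) (f ≫ y))) =
          ⁅ev hG c (f ≫ z), ⁅ev hG d (f ≫ x), ev hG e (f ≫ y)⁆⁆ := by
      rw [← ev_brak, ← ev_brak]
      exact ev_congr hG _ (by simp only [lift_mulD_ι]; ring)
    simp only [LieOps.comp_brak, LieOps.comp_plus, LieOps.comp_nul, ev_plus, ev_nul]
    rw [cyc₁, cyc₂, ev_brak, ev_brak]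
    have hd := comp_dι_mul_self d
    have he := comp_dι_mul_self e
    have hc := comp_dι_mul_self c
    refine hallWitt _ _ _ ?_ ?_ ?_ ?_ ?_
    all_goals
      simp only [← ev_brak, Set.mem_insert_iff, Set.mem_singleton_iff, forall_eq_or_imp, forall_eq]
    all_goals try refine ⟨?_, ?_, ?_⟩
    all_goals
      refine ev_commute hG _ _ _ _ ?_
      simp only [lift_mulD_ι]
      generalize d ≫ dnι R 1 = a at *
      generalize e ≫ dnι R 1 = b at *
      generalize c ≫ dnι R 1 = c at *
      grind
  euclidean X f := by
    let L := lieOps R G hG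
    let f₀ : D R ⊗ X ⟶ L.carrier := snd _ _ ≫ (λ_ X).inv ≫ zeroD R ▷ X ≫ f
    change ∃! b : X ⟶ L.carrier, f = L.plus f₀ (L.scal (fst _ _ ≫ dnι R 1) (snd _ _ ≫ b))
    have key : ∀ b : X ⟶ L.carrier,
        f = L.plus f₀ (L.scal (fst _ _ ≫ dnι R 1) (snd _ _ ≫ b)) ↔
        ∀ (Y : C) (p : Y ⟶ X) (d e : Y ⟶ D R), ev hG (lift d e ≫ mulD R) (p ≫ b) =
          (ev hG e (lift d p ≫ f₀))⁻¹ * ev hG e (lift d p ≫ f) := by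
      intro b
      have e₁ : ∀ (Y : C) (p : Y ⟶ X) (d e : Y ⟶ D R),
          ev hG e (lift d p ≫ L.plus f₀ (L.scal (fst _ _ ≫ dnι R 1) (snd _ _ ≫ b))) =
            ev hG e (lift d p ≫ f₀) * ev hG (lift d e ≫ mulD R) (p ≫ b) := by
        intro Y p d e
        have h : lift e (d ≫ dnι R 1) ≫ smulD R = lift d e ≫ mulD R :=
          d_ext (by rw [lift_mulD_ι, lift_smulD_ι])
        rw [LieOps.comp_plus, LieOps.comp_scal, ev_plus, ev_scal, lift_fst_assoc, lift_snd_assoc, h,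
          lift_snd_assoc]
      constructor
      · intro h Y p d e
        rw [eq_inv_mul_iff_mul_eq, ← e₁, ← h]
      · intro h
        refine lie_ext hG fun Y q e => ?_
        have hq : q = lift (q ≫ fst _ _) (q ≫ snd _ _) := by
          refine CartesianMonoidalCategory.hom_ext _ _ ?_ ?_ <;> simp
        rw [hq, e₁, h, mul_inv_cancel_left]
    let m : (D R ⊗ D R) ⊗ X ⟶ G :=
      (ev hG (fst _ _ ≫ snd _ _) (lift (fst _ _ ≫ fst _ _) (snd _ _) ≫ f₀))⁻¹ *
        ev hG (fst _ _ ≫ snd _ _) (lift (fst _ _ ≫ fst _ _) (snd _ _) ≫ f)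
    have hm : ∀ (Y : C) (p : Y ⟶ X) (q : Y ⟶ D R ⊗ D R), lift q p ≫ m =
        (ev hG (q ≫ snd _ _) (lift (q ≫ fst _ _) p ≫ f₀))⁻¹ *
          ev hG (q ≫ snd _ _) (lift (q ≫ fst _ _) p ≫ f) := by
      intro Y p q
      simp only [m, MonObj.comp_mul, GrpObj.comp_inv, comp_ev, lift_fst_assoc,
        comp_lift_assoc, lift_snd]
    obtain ⟨s, ⟨hs, hs₀⟩, -⟩ := hG.dd m 1 (by
      refine d2_hom_ext' hG (fun Y p d => ?_) (fun Y p d => ?_)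
      · rw [lift_whiskerRight_assoc, hm, MonObj.comp_one, MonObj.comp_one]
        simp only [Category.assoc, d2Inl_fst, d2Inl_snd]
        rw [comp_toUnit_assoc, ev_zeroD, ev_zeroD, inv_one, mul_one]
      · rw [lift_whiskerRight_assoc, hm, MonObj.comp_one, MonObj.comp_one]
        simp only [Category.assoc, d2Inr_fst, d2Inr_snd]
        rw [comp_toUnit_assoc, inv_mul_eq_one]
        have e₀ : lift (toUnit Y ≫ zeroD R) p = p ≫ (λ_ X).inv ≫ zeroD R ▷ X := by
          refine CartesianMonoidalCategory.hom_ext _ _ ?_ ?_ <;> simp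
        simp only [f₀]
        rw [lift_snd_assoc, e₀]
        simp only [Category.assoc])
    have hb : ∀ (Y : C) (p : Y ⟶ X) (d e : Y ⟶ D R), ev hG (lift d e ≫ mulD R) (p ≫ lieMk s hs₀) =
          (ev hG e (lift d p ≫ f₀))⁻¹ * ev hG e (lift d p ≫ f) := by
      intro Y p d e
      refine (val_lieMk s hs₀ p _).trans ?_
      rw [← lift_whiskerRight_assoc, hs, hm, lift_fst, lift_snd]
    exact ⟨lieMk s hs₀, (key _).2 hb, fun b' hb' => lie_ext₂ hG fun Y p d e => by
      rw [(key b').1 hb', hb]⟩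
  microlinear := (hG.exp (D R)).equalizer hG _ _

variable (R G) in
/-- The Lie algebra `Lie G` of a microlinear group. -/
def lieAlgebra (hG : Microlinear k R G) : LieAlgebraObj k R where
  toLieOps := lieOps R G hG
  isLieAlgebra := lieOps_isLieAlgebra hG

end Laws

end

end SDG

/-! An element of `Lie (G ^ U)` is a map `D → G ^ U` that sends `0` to the unit, that is, a function
of two variables `d` and `u`. An element of `(Lie G) ^ U` is a function of the same two variables,
taken in the other order. The unit of `G ^ U` is the constant map with value `1`, so the condition
at `d = 0` on one side says exactly that the condition holds for every `u` on the other. Hence the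
exponential law `expSwap` matches the two subobjects of the double exponentials. This works for any
object `U`, and `U` becomes `D_n` only at the very end.

The operations correspond because each of them is a formula in the values of tangent vectors. With
microlinearity, `(x + y) d = x d * y d` (`ev_plus`), `(-x) d` is the inverse of `x d` (`ev_opp`),
`[x, y] (d e)` is the group commutator of `x d` and `y e` (`ev_brak`), and `(a x) d = x (a d)`
(`ev_scal`). Evaluation at `u` is a group homomorphism from `G ^ U` to `G` (`evalAt`): it preserves
products, inverses and commutators, and it leaves `d` alone. The lemma that carries the proof is
`ev_tr_powSwap`: the value at `d` of the exchanged vector taken at `u` is the evaluation at `u` of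
the value at `d`. Since tangent vectors are determined by their values (`lie_ext`), and even by
their values at products `d e` (`lie_ext₂`), every compatibility reduces to one of these facts.

That `G ^ U` is microlinear is `Microlinear.exp`: `(G ^ U) ^ Spec W` is `(G ^ Spec W) ^ U`,
naturally in `W`, and exponentiation by `U` preserves limits, being a right adjoint. -/

namespace SDG

noncomputable section

/-! ### Evaluation at a point of the exponent is a group homomorphism. -/

section PointwiseGroup

variable {C : Type u} [Category.{v} C] [CartesianMonoidalCategory C] [MonoidalClosed C]
  {U G X Y : C} [GrpObj G]

/-- Evaluation of the generalized elements of `U ⟹ G` at a generalized element of `U`. -/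
def evalAt (u : X ⟶ U) : (X ⟶ (U ⟹ G)) →* (X ⟶ G) where
  toFun x := lift u (𝟙 X) ≫ MonoidalClosed.uncurry x
  -- The group structure of `U ⟹ G` becomes, after transposition, that of the maps `U × X → G`, and
  -- precomposition respects the latter.
  map_one' := by rw [uncurry_one, MonObj.comp_one]
  map_mul' x y := by rw [uncurry_mul, MonObj.comp_mul]

lemma evalAt_apply (u : X ⟶ U) (x : X ⟶ (U ⟹ G)) :
    evalAt u x = lift u (𝟙 X) ≫ MonoidalClosed.uncurry x := rfl

/-- Restriction along `f` only changes the second argument of the transpose. This lets an arbitrary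
element be treated as a restriction of a generic one, whose transpose is known. -/
lemma evalAt_comp (u : Y ⟶ U) (f : Y ⟶ X) (x : X ⟶ (U ⟹ G)) :
    evalAt u (f ≫ x) = lift u f ≫ MonoidalClosed.uncurry x := by
  rw [evalAt_apply, MonoidalClosed.uncurry_natural_left, lift_whiskerLeft_assoc, Category.id_comp]

end PointwiseGroup

/-! ### The exponential law restricts to tangent vectors at the unit. -/

section LieOfPower

variable {k : Type w} [Field k]
variable {C : Type u} [Category.{v} C] [CartesianMonoidalCategory C] [BraidedCategory C]
  [HasFiniteLimits C] [MonoidalClosed C] {R : C} [CommRingObj R] [AlgebraObj k R]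
  {G : C} [GrpObj G] {U X Y : C}

/-- Naturality of the exchange moves the insertion of `0` from the inner slot to the outer one, and
the constant map `1` stays constant under precomposition. This is the condition that `lieMk` asks
for in `lieSwap`. -/
lemma zeroD_exchange (m : U ⊗ (D R ⊗ X) ⟶ G) (h : U ◁ zeroD R ▷ X ≫ m = 1) :
    zeroD R ▷ (U ⊗ X) ≫ exchange (D R) U X ≫ m = 1 := by
  have e := exchange_natural (zeroD R) (𝟙 U) (𝟙 X)
  simp only [id_tensorHom, tensorHom_id, id_whiskerRight] at e
  rw [← Category.assoc, e, Category.assoc, h, MonObj.comp_one]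

/-- The mirror image of `zeroD_exchange`, needed for the map in the opposite direction. -/
lemma exchange_zeroD (m : D R ⊗ (U ⊗ X) ⟶ G) (h : zeroD R ▷ (U ⊗ X) ≫ m = 1) :
    U ◁ zeroD R ▷ X ≫ exchange U (D R) X ≫ m = 1 := by
  have e := exchange_natural (𝟙 U) (zeroD R) (𝟙 X)
  simp only [id_tensorHom, tensorHom_id, id_whiskerRight] at e
  rw [← Category.assoc, e, Category.assoc, h, MonObj.comp_one]

variable (R G U) in
/-- The map `Lie (G ^ U) ⟶ (Lie G) ^ U` which exchanges the two arguments. -/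
def lieSwap : lieObj R (U ⟹ G) ⟶ (U ⟹ lieObj R G) :=
  -- In the manner of Yoneda, the construction is applied to the generic element: `tan (𝟙 _)` is the
  -- universal tangent vector of `U ⟹ G`. Its transpose, exchanged, is a family of tangent vectors
  -- of `G` indexed by `U`.
  MonoidalClosed.curry (lieMk (exchange (D R) U _ ≫ MonoidalClosed.uncurry (tan (𝟙 _)))
    (zeroD_exchange _ (by
      -- Here the unit of `U ⟹ G` has to be pointwise: the generic vector is the unit at `0`, so its
      -- transpose is constantly `1` there.
      rw [← MonoidalClosed.uncurry_natural_left, zeroD_tan, uncurry_one])))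

variable (R G U) in
/-- The map `(Lie G) ^ U ⟶ Lie (G ^ U)` which exchanges the two arguments. -/
def lieSwapInv : (U ⟹ lieObj R G) ⟶ lieObj R (U ⟹ G) :=
  -- The evaluation `uncurry (𝟙 _)` is the generic family of tangent vectors, read as a single
  -- tangent vector at the stage `U × (Lie G) ^ U`.
  lieMk (MonoidalClosed.curry (exchange U (D R) _ ≫ tan (MonoidalClosed.uncurry (𝟙 _)))) (by
    refine MonoidalClosed.uncurry_injective ?_
    rw [MonoidalClosed.uncurry_natural_left, MonoidalClosed.uncurry_curry, uncurry_one]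
    exact exchange_zeroD _ (zeroD_tan _))

/-- Both sides have the same double transpose, namely the exchange followed by the transpose of the
generic tangent vector. The equation says that `lieSwap` is the restriction of the exponential law.
It serves both to invert `lieSwap` and as the last clause of the theorem. -/
lemma lieSwap_map_lieι : lieSwap R G U ≫ (ihom U).map (lieι R G) =
    lieι R (U ⟹ G) ≫ expSwap (D R) U G := by
  refine uncurry₂_injective ?_
  rw [uncurry₂_expSwap, uncurry₂, MonoidalClosed.uncurry_natural_right, lieSwap,
    MonoidalClosed.uncurry_curry]
  -- The goal is `tan_lieMk` up to unfolding: `tan` is by definition the transpose of the composite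
  -- with `lieι`.
  refine (tan_lieMk _ _).trans ?_
  rw [tan, Category.id_comp]
  rfl

/-- The companion of `lieSwap_map_lieι`: the map back is also a restriction of the exponential law.
With both equations, the two maps are inverse because the exchange is an involution. -/
lemma lieSwapInv_lieι : lieSwapInv R G U ≫ lieι R (U ⟹ G) =
    (ihom U).map (lieι R G) ≫ expSwap U (D R) G := by
  refine uncurry₂_injective ?_
  rw [uncurry₂_expSwap]
  have e₁ : MonoidalClosed.uncurry (lieSwapInv R G U ≫ lieι R (U ⟹ G)) =
      MonoidalClosed.curry (exchange U (D R) _ ≫ tan (MonoidalClosed.uncurry (𝟙 _))) :=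
    tan_lieMk _ _
  rw [uncurry₂, e₁, MonoidalClosed.uncurry_curry, tan, ← MonoidalClosed.uncurry_natural_right,
    Category.id_comp]
  rfl

instance : Mono (lieι R G) := inferInstanceAs (Mono (equalizer.ι _ _))

variable (R G U) in
/-- The isomorphism `Lie (G ^ U) ≅ (Lie G) ^ U` of the underlying objects. -/
def lieSwapIso : lieObj R (U ⟹ G) ≅ (U ⟹ lieObj R G) where
  hom := lieSwap R G U
  inv := lieSwapInv R G U
  hom_inv_id := by
    -- Followed by the inclusion, the composite becomes `expSwap` applied twice, which is the
    -- identity.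
    rw [← cancel_mono (lieι R (U ⟹ G)), Category.assoc, lieSwapInv_lieι, ← Category.assoc,
      lieSwap_map_lieι, Category.assoc, expSwap_expSwap, Category.comp_id, Category.id_comp]
  inv_hom_id := by
    -- On this side the inclusion is `lieι` exponentiated by `U`. It can be cancelled because
    -- transposition reduces it to cancelling `lieι` itself.
    refine uncurry_map_injective (lieι R G) ?_
    rw [Category.assoc, lieSwap_map_lieι, ← Category.assoc, lieSwapInv_lieι, Category.assoc,
      expSwap_expSwap, Category.comp_id, Category.id_comp]

/-- With `p = (u, t)`, this is the formula `(swap x) (u) (d) = x (d) (u)` at the parameter `t`. The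
stage `Y` and the element `p` are arbitrary, since elements of an exponential by `U` are compared
through their transposes, at stages over `U × X`. -/
lemma val_uncurry_lieSwap (x : X ⟶ lieObj R (U ⟹ G)) (p : Y ⟶ U ⊗ X) (d : Y ⟶ D R) :
    val d (p ≫ MonoidalClosed.uncurry (x ≫ lieSwap R G U)) =
      evalAt (p ≫ fst _ _) (val d (p ≫ snd _ _ ≫ x)) := by
  -- The value is rewritten through the generic tangent vector, because `lieSwap` is defined on that
  -- one.
  have e : val d (p ≫ snd U X ≫ x) = lift d (p ≫ snd U X ≫ x) ≫ tan (𝟙 _) := by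
    rw [← val_comp, Category.comp_id]
  -- On elements, the exchange takes `(d, (u, x))` to `(u, (d, x))`.
  have e' : lift d (p ≫ U ◁ x) ≫ exchange (D R) U _ =
      lift (p ≫ fst U X) (lift d (p ≫ snd U X ≫ x)) := by
    refine CartesianMonoidalCategory.hom_ext _ _ ?_
      (CartesianMonoidalCategory.hom_ext _ _ ?_ ?_) <;> simp [exchange]
  rw [MonoidalClosed.uncurry_natural_left, lieSwap, MonoidalClosed.uncurry_curry,
    ← Category.assoc, val_lieMk, ← Category.assoc, e', e, evalAt_comp]

/-! ### Compatibility of the exchange with the Lie algebra operations. -/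

variable (hG : Microlinear k R G) (hH : Microlinear k R (U ⟹ G))

/-- `lieSwap`, as a map between the carriers of Lie algebras. -/
abbrev powSwap : (lieOps R (U ⟹ G) hH).carrier ⟶ ((lieOps R G hG).pow U).carrier :=
  lieSwap R G U

/-- `val_uncurry_lieSwap` in the vocabulary of `LieOps`, so that the value formulas `ev_plus`,
`ev_opp`, `ev_scal`, `ev_brak` and the transposition rules of `LieOps.pow` apply to it by rewriting.
-/
lemma ev_tr_powSwap (x : X ⟶ (lieOps R (U ⟹ G) hH).carrier) (p : Y ⟶ U ⊗ X) (d : Y ⟶ D R) :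
    ev hG d (p ≫ LieOps.tr (x ≫ powSwap hG hH)) =
      evalAt (p ≫ fst _ _) (ev hH d (p ≫ snd _ _ ≫ x)) :=
  val_uncurry_lieSwap x p d

lemma nul_powSwap : (lieOps R (U ⟹ G) hH).nul X ≫ powSwap hG hH =
    ((lieOps R G hG).pow U).nul X :=
  LieOps.tr_injective <| lie_ext hG fun Y p d => by
    rw [ev_tr_powSwap, LieOps.tr_nul]
    simp only [LieOps.comp_nul, ev_nul, map_one]

/-- The value of a sum is the product of the values, in `U ⟹ G` as in `G`, and evaluation at `u` is
multiplicative. No extension to `D(2)` has to be compared: its uniqueness is already contained in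
`ev_plus`. -/
lemma plus_powSwap (x y : X ⟶ (lieOps R (U ⟹ G) hH).carrier) :
    (lieOps R (U ⟹ G) hH).plus x y ≫ powSwap hG hH =
      ((lieOps R G hG).pow U).plus (x ≫ powSwap hG hH) (y ≫ powSwap hG hH) :=
  LieOps.tr_injective <| lie_ext hG fun Y p d => by
    rw [ev_tr_powSwap, LieOps.tr_plus]
    simp only [LieOps.comp_plus, ev_plus, map_mul, ev_tr_powSwap]

lemma opp_powSwap (x : X ⟶ (lieOps R (U ⟹ G) hH).carrier) :
    (lieOps R (U ⟹ G) hH).opp x ≫ powSwap hG hH =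
      ((lieOps R G hG).pow U).opp (x ≫ powSwap hG hH) :=
  LieOps.tr_injective <| lie_ext hG fun Y p d => by
    rw [ev_tr_powSwap, LieOps.tr_opp]
    simp only [LieOps.comp_opp, ev_opp, map_inv, ev_tr_powSwap]

/-- Scalar multiplication acts on the argument `d` alone, so it commutes with evaluation at `u`
without any use of the group structure. The scalar in the power is constant along `U`, hence both
sides use the same element of `R`. -/
lemma scal_powSwap (a : X ⟶ R) (x : X ⟶ (lieOps R (U ⟹ G) hH).carrier) :
    (lieOps R (U ⟹ G) hH).scal a x ≫ powSwap hG hH =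
      ((lieOps R G hG).pow U).scal a (x ≫ powSwap hG hH) :=
  LieOps.tr_injective <| lie_ext hG fun Y p d => by
    rw [ev_tr_powSwap, LieOps.tr_scal]
    simp only [LieOps.comp_scal, ev_scal, ev_tr_powSwap]

/-- The bracket is known only through its values at products `d e`, where they are commutators; by
`lie_ext₂` these values suffice. Group homomorphisms preserve commutators, and `evalAt` is one. -/
lemma brak_powSwap (x y : X ⟶ (lieOps R (U ⟹ G) hH).carrier) :
    (lieOps R (U ⟹ G) hH).brak x y ≫ powSwap hG hH =
      ((lieOps R G hG).pow U).brak (x ≫ powSwap hG hH) (y ≫ powSwap hG hH) :=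
  LieOps.tr_injective <| lie_ext₂ hG fun Y p d e => by
    rw [ev_tr_powSwap, LieOps.tr_brak]
    simp only [LieOps.comp_brak, ev_brak, map_commutatorElement, ev_tr_powSwap]

/-! ### From generalized elements to an isomorphism of Lie algebra objects. -/

/-- The isomorphism of Lie algebras `Lie (G ^ U) ≅ (Lie G) ^ U`. -/
def lieAlgebraPowIso :
    LieAlgebraObj.Iso (lieAlgebra R (U ⟹ G) hH) ((lieAlgebra R G hG).pow U) where
  iso := lieSwapIso R G U
  -- The zero is a global element, so the law is read at the terminal stage, where `toUnit` is the
  -- identity.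
  map_zero := by
    have h := nul_powSwap (X := 𝟙_ C) hG hH
    rw [LieOps.nul, LieOps.nul, toUnit_unit, Category.id_comp, Category.id_comp] at h
    exact h
  map_add := by
    -- Yoneda: the law for the two projections, the generic pair of elements, is the equation
    -- between the operations as morphisms.
    have h := plus_powSwap hG hH (fst _ _) (snd _ _)
    rw [LieOps.plus, lift_fst_snd, Category.id_comp] at h
    -- It remains to see that the pair of the two exchanged projections is the exchange tensored
    -- with itself, which is checked on the components.
    refine h.trans (congrArg (· ≫ ((lieOps R G hG).pow U).add) ?_)
    refine CartesianMonoidalCategory.hom_ext _ _ ?_ ?_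
    · exact (lift_fst _ _).trans (tensorHom_fst _ _).symm
    · exact (lift_snd _ _).trans (tensorHom_snd _ _).symm
  map_neg := by
    have h := opp_powSwap hG hH (𝟙 _)
    rw [LieOps.opp, Category.id_comp, Category.id_comp] at h
    exact h
  map_smul := by
    have h := scal_powSwap hG hH (fst _ _) (snd _ _)
    rw [LieOps.scal, lift_fst_snd, Category.id_comp] at h
    refine h.trans (congrArg (· ≫ ((lieOps R G hG).pow U).smul) ?_)
    -- The scalar component is not moved by the exchange, so the pair is a whiskering by `R` here.
    refine CartesianMonoidalCategory.hom_ext _ _ ?_ ?_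
    · exact (lift_fst _ _).trans (whiskerLeft_fst _ _).symm
    · exact (lift_snd _ _).trans (whiskerLeft_snd _ _).symm
  map_bracket := by
    have h := brak_powSwap hG hH (fst _ _) (snd _ _)
    rw [LieOps.brak, lift_fst_snd, Category.id_comp] at h
    refine h.trans (congrArg (· ≫ ((lieOps R G hG).pow U).bracket) ?_)
    refine CartesianMonoidalCategory.hom_ext _ _ ?_ ?_
    · exact (lift_fst _ _).trans (tensorHom_fst _ _).symm
    · exact (lift_snd _ _).trans (tensorHom_snd _ _).symm

end LieOfPower

end

end SDG

/-- The group structure on the prolongation is the pointwise one, so microlinearity is all that a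
Lie group still requires. The final equation says that `φ` is the restriction of the exponential
law; as composition with the exponentiated inclusion is injective, it determines `φ.iso.hom`. -/
theorem theorem3p1 {k : Type w} [Field k] {C : Type u} [CategoryTheory.Category.{v} C]
    [CartesianMonoidalCategory C] [BraidedCategory C] [HasFiniteLimits C] [MonoidalClosed C]
    (R : C) [CommRingObj R] [SDG.AlgebraObj k R] (hR : SDG.KockLawvere (k := k) R)
    (G : C) [GrpObj G] (hG : SDG.Microlinear k R G) (n : ℕ) :
    ∃ hGn : SDG.Microlinear k R (SDG.Dn R n ⟹ G),
    ∃ φ : SDG.LieAlgebraObj.Iso (SDG.lieAlgebra R (SDG.Dn R n ⟹ G) hGn)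
        ((SDG.lieAlgebra R G hG).pow (SDG.Dn R n)),
      φ.iso.hom ≫ (ihom (SDG.Dn R n)).map (SDG.lieι R G) =
        SDG.lieι R (SDG.Dn R n ⟹ G) ≫ SDG.expSwap (SDG.D R) (SDG.Dn R n) G :=
  -- The last component applies because the forward map of `lieAlgebraPowIso` is `lieSwap` by
  -- definition.
  ⟨hG.exp _, SDG.lieAlgebraPowIso hG (hG.exp _), SDG.lieSwap_map_lieι⟩
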